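/- Consider one licensed sub-band $l_s$ of a seller operator $s$, shared by a finite group $Q_{l_s}$ of operators (mobile network operators, MNOs) with $s\in Q_{l_s}$; the members of $Q_{l_s}\setminus\{s\}$ are buyers, and $b$ is one of them. The base stations (BSs) of the operators $k\in Q_{l_s}$ form independent homogeneous Poisson point processes on $\mathbb{R}^2$ with intensities $\lambda_k>0$. A typical user of $b$ is at the origin. The path loss exponent is $\alpha>2$, the noise power is $\sigma^2\ge 0$, the SINR threshold is $\beta>0$, and the channel gains $h$ between the BSs and the user are i.i.d. exponential with unit mean. BSs of the seller transmit with a fixed power $P^{\rm S}>0$. BSs of the buyers transmit with i.i.d. random powers distributed as $P^{\rm B}_{l_s}=\zeta_s/H$, where $\zeta_s>0$ is the interference threshold of the seller and $H=\sup_i g_i\|{\rm x}-{\rm y}_i\|^{-\alpha}$ is the largest channel gain from a location ${\rm x}$ to the users $({\rm y}_i)$ of the seller, which form a homogeneous Poisson process of intensity $\mu_s>0$, with i.i.d. unit-mean exponential gains $g_i$ independent of the users. (The law of $H$ does not depend on ${\rm x}$.) Positions, gains and powers of the BSs are mutually independent. The user is served by the BS of $b$ with the largest average received power, i.e. the one that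 maximizes $P x^{-\alpha}$ among the BSs of $b$, where $P$ is its transmit power and $x$ its distance from the origin. Let $P_0,h_0,x_0$ be the power, gain and distance of the serving BS, let $I$ be the sum of the powers $P h x^{-\alpha}$ received from all other BSs of $b$, from all BSs of $s$ (with $P=P^{\rm S}$) and from all BSs of the operators in $Q_{l_s}\setminus\{s,b\}$, and let $\gamma=P_0h_0x_0^{-\alpha}/(I+\sigma^2)$. Put $M=\mathbb{E}[(P^{\rm B}_{l_s})^{2/\alpha}]$, $\rho(\alpha,\beta)=\int_{\beta^{-2/\alpha}}^{\infty}\frac{d\nu}{1+\nu^{\alpha/2}}$, $\rho(\alpha,\infty)=\int_0^\infty\frac{d\nu}{1+\nu^{\alpha/2}}$, $\lambda_{b,l_s}=\sum_{k\in Q_{l_s}\setminus\{s,b\}}\lambda_k$, and $$\mathcal{L}(\kappa)=\exp\left(-\pi\lambda_b M\kappa^{2/\alpha}\rho(\alpha,\beta)\right)\exp\left(-\pi\lambda_s (P^{\rm S})^{2/\alpha}\kappa^{2/\alpha}\rho(\alpha,\infty)\right)\exp\left(-\pi\lambda_{b,l_s}M\kappa^{2/\alpha}\rho(\alpha,\infty)\right).$$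 Then $M$ and $\rho(\alpha,\infty)$ are finite, $I<\infty$ almost surely, $\mathcal{L}$ is the Laplace transform of the interference in the sense that, with $Z=x_0^2/P_0^{2/\alpha}$, $$\mathbb{E}\left[e^{-\beta Z^{\alpha/2}I}\,\middle|\,Z\right]=\mathcal{L}\left(\beta Z^{\alpha/2}\right)\quad\text{almost surely},$$ and the coverage probability of the user is given by the convergent integral $$\mathbb{P}[\gamma>\beta]=\int_0^\infty \pi\lambda_b M\,e^{-\beta\sigma^2z^{\alpha/2}}\,e^{-\pi\lambda_b M z}\,\mathcal{L}\left(\beta z^{\alpha/2}\right)dz .$$ -/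

import Mathlib

open MeasureTheory ProbabilityTheory Set
open scoped NNReal ENNReal

noncomputable section

namespace SpectrumSharing

/-- The Euclidean plane. -/
abbrev Plane : Type := EuclideanSpace ℝ (Fin 2)

/-- The number of points of the sequence `X` of random points that fall in `B`. -/
def count {Ω : Type*} (X : ℕ → Ω → Plane) (B : Set Plane) (ω : Ω) : ℕ∞ :=
  {n : ℕ | X n ω ∈ B}.encard

/-- The random points `X 0, X 1, …` enumerate a homogeneous Poisson point process of intensity
`r` on the plane: counts in sets of finite area are Poisson with mean `r * area`, and counts in
pairwise disjoint sets are independent. -/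
structure IsPoissonProcess {Ω : Type*} [MeasurableSpace Ω] (X : ℕ → Ω → Plane) (r : ℝ≥0)
    (P : Measure Ω) : Prop where
  measurable : ∀ n, Measurable (X n)
  count_law : ∀ B : Set Plane, MeasurableSet B → volume B ≠ ∞ →
    P.map (count X B) =
      (poissonMeasure (r * (volume B).toNNReal)).map (fun j : ℕ => (j : ℕ∞))
  count_indep : ∀ (m : ℕ) (B : Fin m → Set Plane), (∀ i, MeasurableSet (B i)) →
    (∀ i, volume (B i) ≠ ∞) → Pairwise (fun i j => Disjoint (B i) (B j)) →
    iIndepFun (fun i => count X (B i)) P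

/-! ### Transmit power of a buyer base station -/

/-- The users `Y` of the seller form a Poisson process of intensity `r`, and the channel gains `g`
between them and a given buyer base station are i.i.d. exponential with unit mean and independent
of the positions of the users. -/
structure IsUserField {Ω : Type*} [MeasurableSpace Ω] (Y : ℕ → Ω → Plane) (g : ℕ → Ω → ℝ)
    (r : ℝ≥0) (P : Measure Ω) : Prop where
  poisson : IsPoissonProcess Y r P
  gain_measurable : ∀ i, Measurable (g i)
  gain_law : ∀ i, HasLaw (g i) (expMeasure 1) P
  gain_indep : iIndepFun g P
  indep : IndepFun (fun ω i => Y i ω) (fun ω i => g i ω) P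

/-- The largest channel gain (path loss included) from a base station at `x` to the users `Y`. -/
def largestGain {Ω : Type*} (α : ℝ) (x : Plane) (Y : ℕ → Ω → Plane) (g : ℕ → Ω → ℝ) (ω : Ω) :
    ℝ≥0∞ :=
  ⨆ i, ENNReal.ofReal (g i ω * ‖x - Y i ω‖ ^ (-α))

/-- The maximum power at which a base station at `x` may transmit so that the interference at
every user in `Y` stays below `ζ`. -/
def maxPower {Ω : Type*} (α ζ : ℝ) (x : Plane) (Y : ℕ → Ω → Plane) (g : ℕ → Ω → ℝ) (ω : Ω) : ℝ :=
  (ENNReal.ofReal ζ / largestGain α x Y g ω).toReal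

/-! ### The downlink on one licensed sub-band, seen from the origin -/

/-- The downlink of one licensed sub-band of one seller. -/
structure Downlink (O Ω : Type*) where
  /-- the operators that share the sub-band -/
  group : Finset O
  /-- the operator that owns the sub-band -/
  seller : O
  /-- intensity of the base stations of each operator -/
  intensity : O → ℝ≥0
  /-- transmit power of the base stations of the seller -/
  sellerPower : ℝ
  /-- path loss exponent -/
  α : ℝ
  /-- the noise power is `σ ^ 2` -/
  σ : ℝ
  /-- `bs k n` is the position of the `n`-th base station of operator `k` -/
  bs : O → ℕ → Ω → Plane
  /-- `gain k n` is the channel gain between that base station and the user at the origin -/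
  gain : O → ℕ → Ω → ℝ
  /-- `power k n` is the transmit power of that base station, where `k` is a buyer -/
  power : O → ℕ → Ω → ℝ

namespace Downlink

variable {O Ω : Type*} (D : Downlink O Ω)

/-- The probabilistic model: independent Poisson processes of base stations, i.i.d. Rayleigh
fading (exponential gains of unit mean), i.i.d. transmit powers of the base stations of the buyers
with common law `powerLaw`, and the families of positions, gains and powers are mutually
independent. -/
structure IsModel [MeasurableSpace Ω] [DecidableEq O] (powerLaw : Measure ℝ) (P : Measure Ω) :
    Prop where
  bs_poisson : ∀ k ∈ D.group, IsPoissonProcess (D.bs k) (D.intensity k) P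
  gain_measurable : ∀ k ∈ D.group, ∀ n, Measurable (D.gain k n)
  gain_law : ∀ k ∈ D.group, ∀ n, HasLaw (D.gain k n) (expMeasure 1) P
  power_measurable : ∀ k ∈ D.group.erase D.seller, ∀ n, Measurable (D.power k n)
  power_law : ∀ k ∈ D.group.erase D.seller, ∀ n, HasLaw (D.power k n) powerLaw P
  bs_indep : iIndepFun (fun (k : D.group) ω n => D.bs k n ω) P
  gain_indep : iIndepFun (fun i : D.group × ℕ => D.gain i.1 i.2) P
  power_indep : iIndepFun (fun i : {k // k ∈ D.group.erase D.seller} × ℕ => D.power i.1 i.2) P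
  gain_power_indep : IndepFun (fun ω (i : D.group × ℕ) => D.gain i.1 i.2 ω)
    (fun ω (i : {k // k ∈ D.group.erase D.seller} × ℕ) => D.power i.1 i.2 ω) P
  bs_marks_indep : IndepFun (fun ω (i : D.group × ℕ) => D.bs i.1 i.2 ω)
    (fun ω => ((fun i : D.group × ℕ => D.gain i.1 i.2 ω),
      (fun i : {k // k ∈ D.group.erase D.seller} × ℕ => D.power i.1 i.2 ω))) P

/-- Average (over the fading) power received at the origin from the `n`-th base station of
buyer `k`. -/
def meanReceived (k : O) (n : ℕ) (ω : Ω) : ℝ :=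
  D.power k n ω * ‖D.bs k n ω‖ ^ (-D.α)

/-- Index of the base station of buyer `b` that serves the user at the origin: the first one that
provides the maximum average received power. -/
def serving (b : O) (ω : Ω) : ℕ :=
  sInf {n : ℕ | ∀ m, D.meanReceived b m ω ≤ D.meanReceived b n ω}

/-- The variable `x₀² / P₀ ^ (2/α)`, where `x₀` is the distance of the serving base station and
`P₀` is its transmit power. -/
def servingZ (b : O) (ω : Ω) : ℝ :=
  ‖D.bs b (D.serving b ω) ω‖ ^ 2 / D.power b (D.serving b ω) ω ^ (2 / D.α)

/-- Power received at the origin from the `n`-th base station of buyer `k`. -/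
def received (k : O) (n : ℕ) (ω : Ω) : ℝ≥0∞ :=
  ENNReal.ofReal (D.power k n ω * D.gain k n ω * ‖D.bs k n ω‖ ^ (-D.α))

/-- Interference at the user of buyer `b` at the origin: from the other base stations of `b`, from
the base stations of the seller, and from those of the other buyers that share the sub-band. -/
def interference [DecidableEq O] (b : O) (ω : Ω) : ℝ≥0∞ :=
  (∑' n : ℕ, if n = D.serving b ω then 0 else D.received b n ω)
    + (∑' n : ℕ, ENNReal.ofReal
        (D.sellerPower * D.gain D.seller n ω * ‖D.bs D.seller n ω‖ ^ (-D.α)))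
    + ∑ k ∈ D.group \ {D.seller, b}, ∑' n : ℕ, D.received k n ω

/-- Signal to interference plus noise ratio at the user of buyer `b` at the origin. -/
def sinr [DecidableEq O] (b : O) (ω : Ω) : ℝ≥0∞ :=
  D.received b (D.serving b ω) ω / (D.interference b ω + ENNReal.ofReal (D.σ ^ 2))

end Downlink

/-! ### The closed form -/

/-- `ρ(α, β)`. -/
def rho (α β : ℝ) : ℝ := ∫ v in Ioi (β ^ (-(2 / α))), 1 / (1 + v ^ (α / 2))

/-- `ρ(α, ∞)`. -/
def rhoInf (α : ℝ) : ℝ := ∫ v in Ioi (0 : ℝ), 1 / (1 + v ^ (α / 2))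

/-- The Laplace transform of the interference in closed form; `M` stands for the moment of order
`2/α` of the transmit power of a base station of a buyer. -/
def laplaceFormula {O Ω : Type*} [DecidableEq O] (D : Downlink O Ω) (b : O) (β M κ : ℝ) : ℝ :=
  Real.exp (-(Real.pi * D.intensity b * M * κ ^ (2 / D.α) * rho D.α β))
    * Real.exp (-(Real.pi * D.intensity D.seller * D.sellerPower ^ (2 / D.α) * κ ^ (2 / D.α)
        * rhoInf D.α))
    * Real.exp (-(Real.pi * (∑ k ∈ D.group \ {D.seller, b}, (D.intensity k : ℝ)) * M
        * κ ^ (2 / D.α) * rhoInf D.α))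

/-- The integrand of the coverage probability in closed form. -/
def coverageIntegrand {O Ω : Type*} [DecidableEq O] (D : Downlink O Ω) (b : O) (β M z : ℝ) : ℝ :=
  Real.pi * D.intensity b * M * Real.exp (-(β * D.σ ^ 2 * z ^ (D.α / 2)))
    * Real.exp (-(Real.pi * D.intensity b * M * z))
    * laplaceFormula D b β M (β * z ^ (D.α / 2))

end SpectrumSharing

end

open SpectrumSharing

noncomputable section

namespace SpectrumSharing

/-! Put `a = α/2` and `c = π λ_b M`. The proof avoids conditioning on the serving station and Palm
calculus. It computes the Laplace transform of the total received power, serving signal included, on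
the event `Z > t`, where `Z` is the minimum over the stations of `b` of the path loss variable `|x|²
/ P^(2/α)`. On this event no station of `b` has path loss at most `t`. Giving such stations an
infinite cost turns the expectation into one Laplace functional of marked Poisson processes
(`IsMarkedPoisson.laplace`), whose value is `e^{-Λ(κ,t)}` (`lintegral_totalPower`). Working with
`e⁻ˣ` on `[0, ∞]` lets void probabilities and Laplace transforms share one formula. Averaging over
exponential gains and rescaling the plane leaves only the moment of order `2/α` of each power law
(`lintegral_bsCost`).

The total power equals `I + Z^{-a} h`, where the serving gain `h` is exponential and independent of
`(Z, I)` (`lintegral_serving_gain`). Integrating `h` out gives `E[1_{Z>t} w(Z) e^{-κI}] =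
e^{-Λ(κ,t)}` with `w(u) = 1 - κ/(u^a + κ)`. Since `∂Λ/∂t = c w(t)`, the same factor appears on both
sides after differentiation in `t` and cancels: `E[φ(Z) e^{-κI}] = ∫ φ(u) c e^{-Λ(κ,u)} du`
(`lintegral_servingZ_const`).

This extends to parameters `κ(Z)` by discretisation (`lintegral_servingZ`). For `κ(u) = β u^a`
scaling gives `e^{-Λ(κ(u),u)} = e^{-cu} 𝓛(κ(u))`. Testing against events `Z ∈ A` yields the
conditional Laplace transform. Coverage means `h > β Z^a (I + σ²)`, so the exponential tail of `h`
reduces it to the same identity.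

The transmit power of a buyer is handled by a void probability as well: `H^{-2/α}` is exponential
(`measure_largestGain_le`), hence the power is almost surely positive and `M` is finite. -/

/-! ### The function `x ↦ e⁻ˣ` on `[0, ∞]` -/

/-- The function `x ↦ e⁻ˣ` on `[0, ∞]`. -/
def nexp (x : ℝ≥0∞) : ℝ≥0∞ := EReal.exp (-(x : EReal))

/-- The inverse `q ↦ -log q` of `nexp` on `[0, 1]`. -/
def nlog (q : ℝ≥0∞) : ℝ≥0∞ := (-(ENNReal.log q)).toENNReal

@[simp] lemma nexp_zero : nexp 0 = 1 := by simp [nexp]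

@[simp] lemma nexp_top : nexp ∞ = 0 := by simp [nexp]

lemma nexp_ofReal {x : ℝ} (hx : 0 ≤ x) : nexp (ENNReal.ofReal x) = ENNReal.ofReal (Real.exp (-x)) := by
  rw [nexp, EReal.coe_ennreal_ofReal, max_eq_left hx, ← EReal.coe_neg, EReal.exp_coe]

lemma nexp_eq_ofReal {x : ℝ≥0∞} (hx : x ≠ ∞) :
    nexp x = ENNReal.ofReal (Real.exp (-x.toReal)) := by
  rw [← nexp_ofReal ENNReal.toReal_nonneg, ENNReal.ofReal_toReal hx]

lemma nexp_add (x y : ℝ≥0∞) : nexp (x + y) = nexp x * nexp y := by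
  rcases eq_or_ne x ∞ with rfl | hx
  · simp
  rcases eq_or_ne y ∞ with rfl | hy
  · simp
  rw [nexp_eq_ofReal hx, nexp_eq_ofReal hy, nexp_eq_ofReal (ENNReal.add_ne_top.2 ⟨hx, hy⟩),
    ENNReal.toReal_add hx hy, neg_add, Real.exp_add, ENNReal.ofReal_mul (Real.exp_nonneg _)]

lemma nexp_sum {ι : Type*} (s : Finset ι) (u : ι → ℝ≥0∞) :
    nexp (∑ i ∈ s, u i) = ∏ i ∈ s, nexp (u i) := by
  classical
  induction s using Finset.induction_on with
  | empty => simp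
  | insert a s ha ih => rw [Finset.sum_insert ha, Finset.prod_insert ha, nexp_add, ih]

lemma nexp_strictAnti : StrictAnti nexp := fun x y h => by
  simp only [nexp, EReal.exp_lt_exp_iff, EReal.neg_lt_neg_iff, EReal.coe_ennreal_lt_coe_ennreal_iff]
  exact h

lemma nexp_antitone : Antitone nexp := nexp_strictAnti.antitone

lemma nexp_le_one (x : ℝ≥0∞) : nexp x ≤ 1 := by
  simpa using nexp_antitone (zero_le (a := x))

lemma nexp_ne_top (x : ℝ≥0∞) : nexp x ≠ ∞ := ((nexp_le_one x).trans_lt ENNReal.one_lt_top).ne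

@[fun_prop]
lemma continuous_nexp : Continuous nexp :=
  ENNReal.continuous_exp.comp (continuous_neg.comp continuous_coe_ennreal_ereal)

@[fun_prop]
lemma measurable_nexp : Measurable nexp := continuous_nexp.measurable

lemma nexp_eq_zero_iff {x : ℝ≥0∞} : nexp x = 0 ↔ x = ∞ := by
  rw [← nexp_top, nexp_strictAnti.injective.eq_iff]

@[fun_prop]
lemma measurable_nlog : Measurable nlog := by
  unfold nlog
  exact measurable_ereal_toENNReal.comp
    (continuous_neg.measurable.comp ENNReal.measurable_log)

lemma nexp_nlog {q : ℝ≥0∞} (hq : q ≤ 1) : nexp (nlog q) = q := by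
  rw [nexp, nlog, EReal.coe_toENNReal, neg_neg, ENNReal.exp_log]
  simpa using hq

lemma nexp_mul_natCast (c : ℝ≥0∞) (j : ℕ) : nexp (c * j) = nexp c ^ j := by
  induction j with
  | zero => simp
  | succ j ih => rw [Nat.cast_succ, mul_add, nexp_add, ih, mul_one, pow_succ]

/-! ### The Laplace functional of a Poisson process -/

/-- The Poisson generating function at `q = e^{-c}`; the case `c = ∞`, `q = 0` is the void
probability. -/
lemma lintegral_nexp_poissonMeasure (m : ℝ≥0) (c : ℝ≥0∞) :
    ∫⁻ j, nexp (c * (j : ℝ≥0∞)) ∂(poissonMeasure m) = nexp (m * (1 - nexp c)) := by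
  set q := (nexp c).toReal with hq
  have hqc : nexp c = ENNReal.ofReal q := (ENNReal.ofReal_toReal (nexp_ne_top c)).symm
  have hq0 : 0 ≤ q := ENNReal.toReal_nonneg
  have hq1 : q ≤ 1 := by
    simpa using ENNReal.toReal_mono ENNReal.one_ne_top (nexp_le_one c)
  rw [lintegral_countable']
  simp_rw [nexp_mul_natCast, hqc, poissonMeasure_singleton, ← ENNReal.ofReal_pow hq0]
  have h1 : ∀ j : ℕ, ENNReal.ofReal (q ^ j) * ENNReal.ofReal (Real.exp (-m) * m ^ j / j.factorial)
      = ENNReal.ofReal (Real.exp (-m) * ((m * q) ^ j / j.factorial)) := fun j => by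
    rw [← ENNReal.ofReal_mul (by positivity)]
    congr 1
    rw [mul_pow]; ring
  simp_rw [h1]
  have hs := (NormedSpace.expSeries_div_hasSum_exp ((m : ℝ) * q)).mul_left (Real.exp (-m))
  rw [← ENNReal.ofReal_tsum_of_nonneg (fun j => by positivity) hs.summable, hs.tsum_eq,
    ← Real.exp_eq_exp_ℝ, ← Real.exp_add]
  have h2 : (m : ℝ≥0∞) * (1 - ENNReal.ofReal q) = ENNReal.ofReal (m * (1 - q)) := by
    rw [ENNReal.ofReal_mul m.coe_nonneg, ENNReal.ofReal_sub _ hq0, ENNReal.ofReal_one,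
      ENNReal.ofReal_coe_nnreal]
  rw [h2, nexp_ofReal (mul_nonneg m.coe_nonneg (by linarith))]
  congr 2; ring

lemma tsum_indicator_eq_count {Ω : Type*} (X : ℕ → Ω → Plane) (B : Set Plane) (c : ℝ≥0∞) (ω : Ω) :
    ∑' n, B.indicator (fun _ => c) (X n ω) = c * ((count X B ω : ℕ∞) : ℝ≥0∞) := by
  rw [count, mul_comm, ← ENNReal.tsum_set_const,
    tsum_subtype {n | X n ω ∈ B} fun _ => c]
  rfl

section Poisson

variable {Ω : Type*} [MeasurableSpace Ω] {X : ℕ → Ω → Plane} {r : ℝ≥0} {P : Measure Ω}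

lemma IsPoissonProcess.lintegral_nexp_count [IsProbabilityMeasure P] (h : IsPoissonProcess X r P)
    {B : Set Plane} (hB : MeasurableSet B) (hB' : volume B ≠ ∞) (c : ℝ≥0∞) :
    ∫⁻ ω, nexp (c * ((count X B ω : ℕ∞) : ℝ≥0∞)) ∂P = nexp (r * (volume B * (1 - nexp c))) := by
  have hlaw := h.count_law B hB hB'
  have hprob : IsProbabilityMeasure
      ((poissonMeasure (r * (volume B).toNNReal)).map (fun j : ℕ => (j : ℕ∞))) :=
    Measure.isProbabilityMeasure_map (by fun_prop)
  -- A map that is not a.e. measurable has pushforward `0`, which is not a probability law; so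
  -- `count_law` already forces measurability.
  have hm : AEMeasurable (count X B) P := by
    by_contra hn
    rw [Measure.map_of_not_aemeasurable hn] at hlaw
    rw [← hlaw] at hprob
    exact absurd rfl (hprob.ne_zero)
  rw [← lintegral_map' (f := fun j : ℕ∞ => nexp (c * (j : ℝ≥0∞))) (by fun_prop) hm, hlaw,
    lintegral_map (by fun_prop) (by fun_prop)]
  simp only [ENat.toENNReal_coe]
  rw [lintegral_nexp_poissonMeasure, ENNReal.coe_mul, ENNReal.coe_toNNReal hB', mul_assoc]

/-- The sum splits over the level sets of `φ`, which are disjoint, so the counts are independent.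
The level `0` is left out because it contributes nothing and may have infinite area. -/
lemma IsPoissonProcess.laplace_simpleFunc [IsProbabilityMeasure P] (h : IsPoissonProcess X r P)
    (φ : SimpleFunc Plane ℝ≥0∞) (hφ : ∀ c, c ≠ 0 → volume (φ ⁻¹' {c}) ≠ ∞) :
    ∫⁻ ω, nexp (∑' n, φ (X n ω)) ∂P = nexp (r * ∫⁻ x, 1 - nexp (φ x)) := by
  classical
  set s := φ.range.filter (· ≠ 0) with hs
  have hdecomp : ∀ (F : ℝ≥0∞ → ℝ≥0∞), F 0 = 0 → ∀ x,
      F (φ x) = ∑ c ∈ s, (φ ⁻¹' {c}).indicator (fun _ => F c) x := fun F hF x => by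
    rcases eq_or_ne (φ x) 0 with h0 | h0
    · rw [h0, hF, Finset.sum_eq_zero]
      intro c hc
      rw [indicator_of_notMem]
      simp only [mem_preimage, mem_singleton_iff, h0]
      exact fun h => (Finset.mem_filter.1 hc).2 h.symm
    · rw [Finset.sum_eq_single_of_mem (φ x)]
      · simp
      · simp [hs, h0]
      · intro c _ hc
        rw [indicator_of_notMem]
        simpa using hc.symm
  have hB : ∀ c, MeasurableSet (φ ⁻¹' {c}) := fun c => φ.measurableSet_preimage _
  have hsum : ∀ ω, ∑' n, φ (X n ω) = ∑ c ∈ s, c * ((count X (φ ⁻¹' {c}) ω : ℕ∞) : ℝ≥0∞) := by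
    intro ω
    simp_rw [← tsum_indicator_eq_count]
    rw [← Summable.tsum_finsetSum fun _ _ => ENNReal.summable]
    exact tsum_congr fun n => hdecomp id rfl _
  have hind : iIndepFun (fun c : s => count X (φ ⁻¹' {c.1})) P := by
    have := h.count_indep s.card (fun i => φ ⁻¹' {(s.equivFin.symm i).1}) (fun i => hB _)
      (fun i => hφ _ (Finset.mem_filter.1 (s.equivFin.symm i).2).2) (fun i j hij => by
        refine Disjoint.preimage _ (disjoint_singleton.2 fun h => ?_)
        exact hij (s.equivFin.symm.injective (Subtype.ext h)))
    have h2 := this.precomp s.equivFin.injective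
    simpa using h2
  have hmeas : ∀ c : s, Measurable (fun ω => nexp (c * ((count X (φ ⁻¹' {c.1}) ω : ℕ∞) : ℝ≥0∞))) := by
    intro c
    simp_rw [← tsum_indicator_eq_count]
    refine measurable_nexp.comp (Measurable.tsum fun n => ?_)
    exact (measurable_const.indicator (hB c.1)).comp (h.measurable n)
  have hprod : ∀ ω, nexp (∑' n, φ (X n ω))
      = ∏ c ∈ Finset.univ (α := s), nexp (c.1 * ((count X (φ ⁻¹' {c.1}) ω : ℕ∞) : ℝ≥0∞)) := by
    intro ω
    rw [hsum, nexp_sum, ← Finset.prod_coe_sort]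
  simp_rw [hprod]
  rw [lintegral_prod_eq_prod_lintegral_of_indepFun _
    (fun (c : s) ω => nexp (c.1 * ((count X (φ ⁻¹' {c.1}) ω : ℕ∞) : ℝ≥0∞)))
    (hind.comp (fun (c : s) (j : ℕ∞) => nexp (c.1 * (j : ℝ≥0∞))) (fun c => by fun_prop)) hmeas]
  have : ∀ c : s, ∫⁻ ω, nexp (c.1 * ((count X (φ ⁻¹' {c.1}) ω : ℕ∞) : ℝ≥0∞)) ∂P
      = nexp (r * (volume (φ ⁻¹' {c.1}) * (1 - nexp c.1))) := fun c =>
    h.lintegral_nexp_count (hB _) (hφ _ (Finset.mem_filter.1 c.2).2) _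
  simp_rw [this]
  rw [Finset.prod_coe_sort s (fun c => nexp (r * (volume (φ ⁻¹' {c}) * (1 - nexp c)))), ← nexp_sum,
    ← Finset.mul_sum]
  congr 2
  simp_rw [hdecomp (fun c => 1 - nexp c) (by simp)]
  rw [lintegral_finsetSum _ fun c _ => measurable_const.indicator (hB c)]
  refine Finset.sum_congr rfl fun c _ => ?_
  rw [lintegral_indicator_const (hB c), mul_comm]

/-- The Laplace functional of a homogeneous Poisson process. -/
lemma IsPoissonProcess.laplace [IsProbabilityMeasure P] (h : IsPoissonProcess X r P)
    {f : Plane → ℝ≥0∞} (hf : Measurable f) :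
    ∫⁻ ω, nexp (∑' n, f (X n ω)) ∂P = nexp (r * ∫⁻ x, 1 - nexp (f x)) := by
  have hball : ∀ N : ℕ, MeasurableSet (Metric.ball (0 : Plane) N) := fun N => measurableSet_ball
  -- Truncation to balls gives the nonzero level sets finite area, as the simple case requires.
  set φ : ℕ → SimpleFunc Plane ℝ≥0∞ := fun N =>
    (SimpleFunc.eapprox f N).restrict (Metric.ball 0 N) with hφ
  have hmono : Monotone φ := fun N K hNK x => by
    simp only [hφ, SimpleFunc.restrict_apply _ (hball _)]
    refine (indicator_le_indicator (SimpleFunc.monotone_eapprox f hNK x)).trans ?_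
    exact indicator_le_indicator_of_subset (Metric.ball_subset_ball (by exact_mod_cast hNK))
      (fun _ => zero_le) x
  have hsup : ∀ x, ⨆ N, φ N x = f x := fun x => by
    refine le_antisymm (iSup_le fun N => ?_) ?_
    · simp only [hφ, SimpleFunc.restrict_apply _ (hball _)]
      refine (indicator_le_self _ _ _).trans ?_
      rw [← SimpleFunc.iSup_eapprox_apply hf x]
      exact le_iSup (fun N => SimpleFunc.eapprox f N x) N
    · rw [← SimpleFunc.iSup_eapprox_apply hf x]
      refine iSup_le fun N => ?_
      obtain ⟨K, hK⟩ := exists_nat_gt ‖x‖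
      refine (SimpleFunc.monotone_eapprox f (le_max_left N K) x).trans ?_
      refine le_trans (le_of_eq ?_) (le_iSup _ (max N K))
      simp only [hφ, SimpleFunc.restrict_apply _ (hball _)]
      rw [indicator_of_mem]
      rw [mem_ball_zero_iff]
      exact hK.trans_le (by exact_mod_cast le_max_right N K)
  have hfin : ∀ N c, c ≠ 0 → volume (φ N ⁻¹' {c}) ≠ ∞ := fun N c hc => by
    rw [hφ, SimpleFunc.restrict_preimage_singleton _ (hball N) hc]
    exact ((measure_mono inter_subset_left).trans_lt measure_ball_lt_top).ne
  have hstep := fun N => h.laplace_simpleFunc (φ N) (hfin N)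
  have hconv : ∀ x, Filter.Tendsto (fun N => φ N x) Filter.atTop (nhds (f x)) := fun x => by
    rw [← hsup x]; exact tendsto_atTop_iSup fun N K hNK => hmono hNK x
  have hsumconv : ∀ ω, Filter.Tendsto (fun N => ∑' n, φ N (X n ω)) Filter.atTop
      (nhds (∑' n, f (X n ω))) := fun ω => by
    -- The series is an integral against counting measure, so monotone convergence applies.
    simp_rw [← lintegral_count]
    exact lintegral_tendsto_of_tendsto_of_monotone (fun N => by fun_prop)
      (.of_forall fun n N K hNK => hmono hNK _) (.of_forall fun n => hconv _)
  have hL : Filter.Tendsto (fun N => ∫⁻ ω, nexp (∑' n, φ N (X n ω)) ∂P) Filter.atTop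
      (nhds (∫⁻ ω, nexp (∑' n, f (X n ω)) ∂P)) := by
    refine tendsto_lintegral_of_dominated_convergence (fun _ => 1) (fun N => ?_)
      (fun N => .of_forall fun ω => nexp_le_one _) (by simp)
      (.of_forall fun ω => (continuous_nexp.tendsto _).comp (hsumconv ω))
    exact measurable_nexp.comp (Measurable.tsum fun n => (φ N).measurable.comp (h.measurable n))
  have hR : Filter.Tendsto (fun N => ∫⁻ x, 1 - nexp (φ N x)) Filter.atTop
      (nhds (∫⁻ x, 1 - nexp (f x))) := by
    refine lintegral_tendsto_of_tendsto_of_monotone (fun N => ?_)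
      (.of_forall fun x N K hNK => tsub_le_tsub_left (nexp_antitone (hmono hNK x)) _)
      (.of_forall fun x => ?_)
    · exact (measurable_const.sub (measurable_nexp.comp (φ N).measurable)).aemeasurable
    · exact ENNReal.Tendsto.sub tendsto_const_nhds ((continuous_nexp.tendsto _).comp (hconv x))
        (Or.inl ENNReal.one_ne_top)
  refine tendsto_nhds_unique hL ?_
  simp_rw [hstep]
  exact (continuous_nexp.tendsto _).comp (ENNReal.Tendsto.const_mul hR (Or.inr ENNReal.coe_ne_top))

end Poisson

/-! ### Independently marked Poisson processes -/

/-- Expectations of finite products factor, and bounded convergence passes to the countable family.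
Using `nlog` writes the infinite product as `nexp` of a sum. -/
lemma lintegral_nexp_tsum_of_iIndepFun {ι Ω : Type*} [Countable ι] [MeasurableSpace Ω]
    {P : Measure Ω} {u : ι → Ω → ℝ≥0∞} (hu : ∀ i, Measurable (u i)) (hind : iIndepFun u P) :
    ∫⁻ ω, nexp (∑' i, u i ω) ∂P = nexp (∑' i, nlog (∫⁻ ω, nexp (u i ω) ∂P)) := by
  have := hind.isProbabilityMeasure
  have hle : ∀ i, ∫⁻ ω, nexp (u i ω) ∂P ≤ 1 := fun i =>
    (lintegral_mono fun ω => nexp_le_one _).trans (by simp)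
  have hL : Filter.Tendsto (fun s : Finset ι => ∫⁻ ω, nexp (∑ i ∈ s, u i ω) ∂P) Filter.atTop
      (nhds (∫⁻ ω, nexp (∑' i, u i ω) ∂P)) :=
    tendsto_lintegral_filter_of_dominated_convergence (fun _ => 1)
      (.of_forall fun s => by fun_prop) (.of_forall fun s => .of_forall fun ω => nexp_le_one _)
      (by simp) (.of_forall fun ω => (continuous_nexp.tendsto _).comp ENNReal.summable.hasSum)
  have hR : Filter.Tendsto (fun s : Finset ι => nexp (∑ i ∈ s, nlog (∫⁻ ω, nexp (u i ω) ∂P)))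
      Filter.atTop (nhds (nexp (∑' i, nlog (∫⁻ ω, nexp (u i ω) ∂P)))) :=
    (continuous_nexp.tendsto _).comp ENNReal.summable.hasSum
  refine tendsto_nhds_unique hL (hR.congr fun s => ?_)
  simp_rw [nexp_sum, nexp_nlog (hle _)]
  exact (lintegral_prod_eq_prod_lintegral_of_indepFun s (fun i ω => nexp (u i ω))
    (hind.comp (fun _ => nexp) fun _ => measurable_nexp)
    fun i => measurable_nexp.comp (hu i)).symm

variable {ι Ω E : Type*} [MeasurableSpace Ω] [MeasurableSpace E]

/-- Finitely many independent Poisson processes, the points of which carry independent marks that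
are independent of the positions; the marks of the process `k` have law `ν k`. -/
structure IsMarkedPoisson (X : ι → ℕ → Ω → Plane) (m : ι → ℕ → Ω → E) (r : ι → ℝ≥0)
    (ν : ι → Measure E) (P : Measure Ω) : Prop where
  poisson : ∀ k, IsPoissonProcess (X k) (r k) P
  indep : iIndepFun (fun k ω n => X k n ω) P
  mark_measurable : ∀ k n, Measurable (m k n)
  mark_law : ∀ k n, P.map (m k n) = ν k
  mark_indep : iIndepFun (fun i : ι × ℕ => m i.1 i.2) P
  indep_mark : IndepFun (fun ω (i : ι × ℕ) => X i.1 i.2 ω) (fun ω (i : ι × ℕ) => m i.1 i.2 ω) P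

namespace IsMarkedPoisson

variable {X : ι → ℕ → Ω → Plane} {m : ι → ℕ → Ω → E} {r : ι → ℝ≥0} {ν : ι → Measure E}
  {P : Measure Ω} [IsProbabilityMeasure P]

lemma isProbabilityMeasure (h : IsMarkedPoisson X m r ν P) (k : ι) : IsProbabilityMeasure (ν k) := by
  rw [← h.mark_law k 0]
  exact Measure.isProbabilityMeasure_map (h.mark_measurable k 0).aemeasurable

/-- The Laplace functional of independently marked Poisson processes. -/
theorem laplace [Fintype ι] (h : IsMarkedPoisson X m r ν P) {f : ι → Plane × E → ℝ≥0∞}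
    (hf : ∀ k, Measurable (f k)) :
    ∫⁻ ω, nexp (∑ k, ∑' n, f k (X k n ω, m k n ω)) ∂P
      = nexp (∑ k, r k * ∫⁻ x, ∫⁻ e, 1 - nexp (f k (x, e)) ∂(ν k)) := by
  have hν := h.isProbabilityMeasure
  have hA : Measurable (fun ω (i : ι × ℕ) => X i.1 i.2 ω) :=
    measurable_pi_lambda _ fun i => (h.poisson i.1).measurable i.2
  have hB : Measurable (fun ω (i : ι × ℕ) => m i.1 i.2 ω) :=
    measurable_pi_lambda _ fun i => h.mark_measurable i.1 i.2
  set Φ : (ι × ℕ → Plane) × (ι × ℕ → E) → ℝ≥0∞ :=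
    fun p => nexp (∑' i : ι × ℕ, f i.1 (p.1 i, p.2 i)) with hΦ
  have hΦm : Measurable Φ := by
    refine measurable_nexp.comp (Measurable.tsum fun i => (hf i.1).comp ?_)
    fun_prop
  -- For fixed positions, averaging over the marks replaces the cost `f` by `F = -log E[e^{-f}]`, a
  -- cost of the position alone; the unmarked Laplace functional then finishes.
  set F : ι → Plane → ℝ≥0∞ := fun k x => nlog (∫⁻ e, nexp (f k (x, e)) ∂(ν k)) with hF
  have hFm : ∀ k, Measurable (F k) := fun k =>
    measurable_nlog.comp ((measurable_nexp.comp (hf k)).lintegral_prod_right')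
  have hnF : ∀ k x, 1 - nexp (F k x) = ∫⁻ e, 1 - nexp (f k (x, e)) ∂(ν k) := fun k x => by
    have h1 : ∫⁻ e, nexp (f k (x, e)) ∂(ν k) ≤ 1 :=
      (lintegral_mono fun e => nexp_le_one _).trans (by simp)
    rw [hF, nexp_nlog h1, lintegral_sub (f := fun _ => 1)
      (g := fun e => nexp (f k (x, e))) ((measurable_nexp.comp (hf k)).comp measurable_prodMk_left)
      (h1.trans_lt ENNReal.one_lt_top).ne (.of_forall fun e => nexp_le_one _)]
    simp
  have hsplit : ∀ ω, nexp (∑ k, ∑' n, f k (X k n ω, m k n ω))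
      = Φ (fun i => X i.1 i.2 ω, fun i => m i.1 i.2 ω) := fun ω => by
    simp only [hΦ]
    rw [ENNReal.tsum_prod', tsum_fintype]
  have hinner : ∀ a : ι × ℕ → Plane, ∫⁻ ω, Φ (a, fun i => m i.1 i.2 ω) ∂P
      = nexp (∑ k, ∑' n, F k (a (k, n))) := fun a => by
    have hu : ∀ i : ι × ℕ, Measurable (fun e => f i.1 (a i, e)) := fun i =>
      (hf i.1).comp measurable_prodMk_left
    simp only [hΦ]
    rw [lintegral_nexp_tsum_of_iIndepFun (u := fun (i : ι × ℕ) ω => f i.1 (a i, m i.1 i.2 ω))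
      (fun i => (hu i).comp (h.mark_measurable i.1 i.2))
      (h.mark_indep.comp (fun i e => f i.1 (a i, e)) hu), ENNReal.tsum_prod', tsum_fintype]
    refine congrArg nexp (Finset.sum_congr rfl fun k _ => tsum_congr fun n => ?_)
    simp only [hF]
    rw [← h.mark_law k n, lintegral_map (f := fun e => nexp (f k (a (k, n), e)))
      (measurable_nexp.comp (hu (k, n))) (h.mark_measurable k n)]
  simp_rw [hsplit]
  rw [← lintegral_map (f := Φ) (g := fun ω => ((fun i : ι × ℕ => X i.1 i.2 ω),
      fun i : ι × ℕ => m i.1 i.2 ω)) hΦm (hA.prodMk hB),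
    h.indep_mark.map_prod_eq_prod_map_map hA.aemeasurable hB.aemeasurable,
    lintegral_prod _ hΦm.aemeasurable,
    lintegral_map (hΦm.lintegral_prod_right') hA]
  have hB' : ∀ a : ι × ℕ → Plane, ∫⁻ y, Φ (a, y) ∂(P.map fun ω (i : ι × ℕ) => m i.1 i.2 ω)
      = ∫⁻ ω, Φ (a, fun i => m i.1 i.2 ω) ∂P := fun a =>
    lintegral_map (hΦm.comp measurable_prodMk_left) hB
  simp_rw [hB', hinner, nexp_sum, ← hnF]
  have hsm : ∀ k, Measurable (fun a : ℕ → Plane => nexp (∑' n, F k (a n))) := fun k =>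
    measurable_nexp.comp (Measurable.tsum fun n => (hFm k).comp (measurable_pi_apply n))
  have hprod := lintegral_prod_eq_prod_lintegral_of_indepFun Finset.univ
    (fun k ω => nexp (∑' n, F k (X k n ω)))
    (h.indep.comp (fun k (a : ℕ → Plane) => nexp (∑' n, F k (a n))) hsm)
    (fun k => (hsm k).comp (measurable_pi_lambda _ fun n => (h.poisson k).measurable n))
  rw [hprod]
  exact Finset.prod_congr rfl fun k _ => (h.poisson k).laplace (hFm k)

lemma laplace_single [Fintype ι] (h : IsMarkedPoisson X m r ν P) (k : ι) {f : Plane × E → ℝ≥0∞}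
    (hf : Measurable f) :
    ∫⁻ ω, nexp (∑' n, f (X k n ω, m k n ω)) ∂P
      = nexp (r k * ∫⁻ x, ∫⁻ e, 1 - nexp (f (x, e)) ∂(ν k)) := by
  classical
  have := h.laplace (f := fun j => if j = k then f else 0) (fun j => by
    split_ifs
    · exact hf
    · exact measurable_const)
  have hL : ∀ ω, ∑ j, ∑' n, (if j = k then f else 0) (X j n ω, m j n ω)
      = ∑' n, f (X k n ω, m k n ω) := fun ω => by
    rw [Finset.sum_eq_single k (fun j _ hj => by simp [hj]) (by simp)]
    simp
  simp_rw [hL] at this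
  rw [this, Finset.sum_eq_single k (fun j _ hj => by simp [hj]) (by simp)]
  simp

/-- A sum over a marked Poisson process is almost surely finite under the usual integrability
condition. -/
lemma ae_tsum_ne_top [Fintype ι] (h : IsMarkedPoisson X m r ν P) (k : ι) {f : Plane × E → ℝ≥0∞}
    (hf : Measurable f) (hfin : ∀ p, f p ≠ ∞)
    (hint : ∫⁻ x, ∫⁻ e, 1 - nexp (f (x, e)) ∂(ν k) ≠ ∞) :
    ∀ᵐ ω ∂P, ∑' n, f (X k n ω, m k n ω) ≠ ∞ := by
  have hν := h.isProbabilityMeasure k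
  set S : Ω → ℝ≥0∞ := fun ω => ∑' n, f (X k n ω, m k n ω) with hS
  have hSm : Measurable S := Measurable.tsum fun n =>
    hf.comp (((h.poisson k).measurable n).prodMk (h.mark_measurable k n))
  -- Factors in `(0, 1]` that tend to `0`. Being nonzero they keep `c * ∞ = ∞`, so `E[e^{-cS}] ≤ P(S
  -- < ∞)`; being at most `1` they let `hint` dominate the exponent, which tends to `0`. Hence `P(S
  -- < ∞) = 1`.
  set c : ℕ → ℝ≥0∞ := fun N => ((N + 1 : ℕ) : ℝ≥0∞)⁻¹ with hc
  have hc0 : Filter.Tendsto c Filter.atTop (nhds 0) :=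
    (Filter.tendsto_add_atTop_iff_nat 1).2 ENNReal.tendsto_inv_nat_nhds_zero
  have hc1 : ∀ N, c N ≤ 1 := fun N => ENNReal.inv_le_one.2 (by exact_mod_cast Nat.le_add_left 1 N)
  have hcne : ∀ N, c N ≠ 0 := fun N => ENNReal.inv_ne_zero.2 (ENNReal.natCast_ne_top _)
  have hstep : ∀ N, ∫⁻ ω, nexp (c N * S ω) ∂P
      = nexp (r k * ∫⁻ p, 1 - nexp (c N * f p) ∂(volume.prod (ν k))) := fun N => by
    have hm : Measurable fun p => c N * f p := hf.const_mul _
    rw [lintegral_prod _ (by fun_prop), ← h.laplace_single k hm]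
    simp_rw [hS, ENNReal.tsum_mul_left]
  have hlim : Filter.Tendsto (fun N => ∫⁻ p, 1 - nexp (c N * f p) ∂(volume.prod (ν k)))
      Filter.atTop (nhds (∫⁻ p, 0 ∂((volume : Measure Plane).prod (ν k)))) := by
    refine tendsto_lintegral_of_dominated_convergence (fun p => 1 - nexp (f p))
      (fun N => by fun_prop) (fun N => .of_forall fun p => ?_) ?_ (.of_forall fun p => ?_)
    · refine tsub_le_tsub_left (nexp_antitone ?_) _
      exact (mul_le_mul_left (hc1 N) _).trans (by simp)
    · rwa [lintegral_prod _ (by fun_prop)]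
    · have h1 : Filter.Tendsto (fun N => c N * f p) Filter.atTop (nhds 0) := by
        simpa using ENNReal.Tendsto.mul_const hc0 (Or.inr (hfin p))
      have h2 := ENNReal.Tendsto.sub (tendsto_const_nhds (x := (1 : ℝ≥0∞)))
        ((continuous_nexp.tendsto _).comp h1) (Or.inl ENNReal.one_ne_top)
      simpa using h2
  have hlim2 : Filter.Tendsto (fun N => ∫⁻ ω, nexp (c N * S ω) ∂P) Filter.atTop (nhds 1) := by
    simp_rw [hstep]
    rw [lintegral_zero] at hlim
    simpa [Function.comp_def] using (continuous_nexp.tendsto _).comp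
      (ENNReal.Tendsto.const_mul hlim (Or.inr (ENNReal.coe_ne_top (r := r k))))
  have hmS : MeasurableSet {ω | S ω ≠ ∞} := (hSm (measurableSet_singleton ∞)).compl
  have hbound : ∀ N, ∫⁻ ω, nexp (c N * S ω) ∂P ≤ P {ω | S ω ≠ ∞} := fun N => by
    rw [← lintegral_indicator_one hmS]
    refine lintegral_mono fun ω => ?_
    by_cases hω : S ω = ∞
    · simp [hω, ENNReal.mul_top (hcne N)]
    · rw [indicator_of_mem (by exact hω)]
      exact nexp_le_one _
  exact (prob_compl_eq_zero_iff hmS).2 (le_antisymm prob_le_one (le_of_tendsto' hlim2 hbound))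

end IsMarkedPoisson

/-! ### Radial integrals on the plane -/

lemma volume_norm_sq_le (c : ℝ) :
    volume {y : Plane | ‖y‖ ^ 2 ≤ c} = ENNReal.ofReal (Real.pi * c) := by
  rcases lt_or_ge c 0 with hc | hc
  · have : {y : Plane | ‖y‖ ^ 2 ≤ c} = ∅ := by
      ext y
      simpa using hc.trans_le (sq_nonneg ‖y‖)
    rw [this, measure_empty, ENNReal.ofReal_of_nonpos]
    exact mul_nonpos_of_nonneg_of_nonpos Real.pi_nonneg hc.le
  · have : {y : Plane | ‖y‖ ^ 2 ≤ c} = Metric.closedBall 0 (√c) := by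
      ext y
      simp [Real.le_sqrt (norm_nonneg y) hc]
    rw [this, EuclideanSpace.volume_closedBall_fin_two, ← ENNReal.ofReal_pow (Real.sqrt_nonneg _),
      Real.sq_sqrt hc, mul_comm, ENNReal.ofReal_mul Real.pi_nonneg]

/-- A disc of squared radius `c` has area `π c`, so the squared distance has constant density `π`.
This makes every planar exponent one-dimensional. -/
lemma map_norm_sq : (volume : Measure Plane).map (fun y => ‖y‖ ^ 2)
    = ENNReal.ofReal Real.pi • volume.restrict (Ioi (0 : ℝ)) := by
  have hm : Measurable (fun y : Plane => ‖y‖ ^ 2) := by fun_prop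
  have hIic : ∀ c : ℝ, (volume : Measure Plane).map (fun y => ‖y‖ ^ 2) (Iic c)
      = ENNReal.ofReal (Real.pi * c) := fun c => by
    rw [Measure.map_apply hm measurableSet_Iic]
    exact volume_norm_sq_le c
  have hIic' : ∀ c : ℝ, (ENNReal.ofReal Real.pi • volume.restrict (Ioi (0 : ℝ))) (Iic c)
      = ENNReal.ofReal (Real.pi * c) := fun c => by
    rw [Measure.smul_apply, Measure.restrict_apply measurableSet_Iic, Iic_inter_Ioi, Real.volume_Ioc,
      sub_zero, ENNReal.ofReal_mul Real.pi_nonneg, smul_eq_mul]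
  refine Measure.ext_of_Ioc' _ _ (fun a b _ => ?_) (fun a b _ => ?_)
  · refine ((measure_mono Ioc_subset_Iic_self).trans_lt ?_).ne
    rw [hIic]
    exact ENNReal.ofReal_lt_top
  · rw [← Iic_sdiff_Iic, measure_sdiff (Iic_subset_Iic.2 (by order)) measurableSet_Iic.nullMeasurableSet
      (by simp [hIic]), measure_sdiff (Iic_subset_Iic.2 (by order)) measurableSet_Iic.nullMeasurableSet
      (by rw [hIic']; simp), hIic, hIic, hIic', hIic']

lemma lintegral_norm_sq {φ : ℝ → ℝ≥0∞} (hφ : Measurable φ) :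
    ∫⁻ y : Plane, φ (‖y‖ ^ 2) = ENNReal.ofReal Real.pi * ∫⁻ u in Ioi (0 : ℝ), φ u := by
  rw [← lintegral_map (g := fun y : Plane => ‖y‖ ^ 2) hφ (by fun_prop), map_norm_sq,
    lintegral_smul_measure, smul_eq_mul]

lemma setLIntegral_Ioi_comp_div (φ : ℝ → ℝ≥0∞) {a : ℝ} (ha : 0 < a) :
    ∫⁻ u in Ioi (0 : ℝ), φ (u / a) = ENNReal.ofReal a * ∫⁻ u in Ioi (0 : ℝ), φ u := by
  have hemb : MeasurableEmbedding (fun u : ℝ => a * u) :=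
    (Homeomorph.mulLeft₀ a ha.ne').measurableEmbedding
  rw [← lintegral_indicator measurableSet_Ioi, ← lintegral_indicator measurableSet_Ioi]
  conv_lhs => rw [← Real.smul_map_volume_mul_left ha.ne']
  rw [lintegral_smul_measure, hemb.lintegral_map, abs_of_pos ha, smul_eq_mul]
  congr 1
  refine lintegral_congr fun u => ?_
  by_cases hu : 0 < u
  · rw [indicator_of_mem (mem_Ioi.2 (mul_pos ha hu)), indicator_of_mem (mem_Ioi.2 hu),
      mul_div_cancel_left₀ _ ha.ne']
  · rw [indicator_of_notMem (by simpa [ha] using hu), indicator_of_notMem (by simpa using hu)]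

lemma lintegral_norm_sq_div {φ : ℝ → ℝ≥0∞} (hφ : Measurable φ) {a : ℝ} (ha : 0 < a) :
    ∫⁻ y : Plane, φ (‖y‖ ^ 2 / a)
      = ENNReal.ofReal Real.pi * (ENNReal.ofReal a * ∫⁻ u in Ioi (0 : ℝ), φ u) := by
  rw [lintegral_norm_sq (φ := fun u => φ (u / a)) (by fun_prop), setLIntegral_Ioi_comp_div φ ha]

/-! ### Exponential gains -/

instance : IsProbabilityMeasure (expMeasure 1) := isProbabilityMeasure_expMeasure one_pos

lemma expMeasure_Ioi {a : ℝ} (ha : 0 ≤ a) : expMeasure 1 (Ioi a) = ENNReal.ofReal (Real.exp (-a)) := by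
  have h := cdf_expMeasure_eq one_pos a
  rw [if_pos ha, one_mul, cdf_eq_real] at h
  rw [← compl_Iic, prob_compl_eq_one_sub measurableSet_Iic, ← ofReal_measureReal, h,
    ← ENNReal.ofReal_one, ← ENNReal.ofReal_sub _ (by simpa using ha)]
  congr 1; ring

lemma expMeasure_lt_ofReal (a : ℝ≥0∞) : expMeasure 1 {h | a < ENNReal.ofReal h} = nexp a := by
  rcases eq_or_ne a ∞ with rfl | ha
  · simp
  · have : {h | a < ENNReal.ofReal h} = Ioi a.toReal := by
      ext h
      simp [ENNReal.lt_ofReal_iff_toReal_lt ha]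
    rw [this, expMeasure_Ioi ENNReal.toReal_nonneg, nexp_eq_ofReal ha]

lemma ae_pos_expMeasure : ∀ᵐ h ∂(expMeasure 1), 0 < h := by
  refine (prob_compl_eq_zero_iff (measurableSet_Ioi (a := (0 : ℝ)))).2 ?_
  rw [expMeasure_Ioi le_rfl]; simp

lemma lintegral_nexp_mul_expMeasure {s : ℝ} (hs : 0 ≤ s) :
    ∫⁻ h, nexp (ENNReal.ofReal (s * h)) ∂(expMeasure 1) = ENNReal.ofReal (1 / (1 + s)) := by
  have hE : expMeasure 1 = volume.withDensity (exponentialPDF 1) := rfl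
  rw [lintegral_congr_ae (g := fun h => ENNReal.ofReal (Real.exp (-(s * h)))) (by
    filter_upwards [ae_pos_expMeasure] with h hh
    rw [nexp_ofReal (by positivity)]), hE,
    lintegral_withDensity_eq_lintegral_mul _ (f := exponentialPDF 1)
      (measurable_exponentialPDFReal 1).ennreal_ofReal
      (by fun_prop)]
  have h1 : (exponentialPDF 1 * fun h => ENNReal.ofReal (Real.exp (-(s * h))))
      = (Ici (0 : ℝ)).indicator fun h => ENNReal.ofReal (Real.exp (-(1 + s) * h)) := by
    ext h
    rw [Pi.mul_apply, exponentialPDF_eq]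
    by_cases hh : 0 ≤ h
    · rw [if_pos hh, indicator_of_mem (mem_Ici.2 hh), one_mul, one_mul,
        ← ENNReal.ofReal_mul (Real.exp_nonneg _), ← Real.exp_add]
      congr 2; ring
    · rw [if_neg hh, indicator_of_notMem (by simpa using hh)]; simp
  rw [h1, lintegral_indicator measurableSet_Ici, setLIntegral_congr Ioi_ae_eq_Ici.symm,
    ← ofReal_integral_eq_lintegral_ofReal (integrableOn_exp_mul_Ioi (by linarith) 0)
      (.of_forall fun h => Real.exp_nonneg _), integral_exp_mul_Ioi (by linarith)]
  rw [mul_zero, Real.exp_zero, neg_div_neg_eq]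

/-! ### The integrals `ρ` -/

lemma integrableOn_one_div_one_add_rpow {a : ℝ} (ha : 1 < a) :
    IntegrableOn (fun v : ℝ => 1 / (1 + v ^ a)) (Ioi 0) := by
  have hm : Measurable fun v : ℝ => 1 / (1 + v ^ a) := by fun_prop
  rw [← Ioc_union_Ioi_eq_Ioi zero_le_one, integrableOn_union]
  constructor
  · refine Measure.integrableOn_of_bounded (M := 1) (by simp) hm.aestronglyMeasurable ?_
    filter_upwards [ae_restrict_mem measurableSet_Ioc] with v hv
    have : 0 ≤ v ^ a := Real.rpow_nonneg hv.1.le _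
    rw [Real.norm_of_nonneg (by positivity), div_le_one (by positivity)]
    linarith
  · refine (integrableOn_Ioi_rpow_of_lt (a := -a) (by linarith) one_pos).mono'
      hm.aestronglyMeasurable ?_
    filter_upwards [ae_restrict_mem measurableSet_Ioi] with v hv
    have hv0 : 0 < v := one_pos.trans hv
    have : 0 < v ^ a := Real.rpow_pos_of_pos hv0 _
    rw [Real.norm_of_nonneg (by positivity), Real.rpow_neg hv0.le, one_div]
    gcongr
    linarith

/-- The substitution `v = κ^(-1/a) w` normalises the integrands to that of `ρ`. -/
lemma div_rpow_add_eq {a κ w : ℝ} (ha : 0 < a) (hκ : 0 < κ) (hw : 0 ≤ w) :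
    κ / (w ^ a + κ) = 1 / (1 + (κ ^ (-(1 / a)) * w) ^ a) := by
  rw [Real.mul_rpow (Real.rpow_nonneg hκ.le _) hw, ← Real.rpow_mul hκ.le]
  have : -(1 / a) * a = -1 := by field_simp
  rw [this, Real.rpow_neg_one]
  have : 0 ≤ w ^ a := Real.rpow_nonneg hw a
  field_simp
  ring

lemma integrableOn_div_rpow_add {a κ : ℝ} (ha : 1 < a) (hκ : 0 ≤ κ) :
    IntegrableOn (fun w : ℝ => κ / (w ^ a + κ)) (Ioi 0) := by
  rcases hκ.eq_or_lt with rfl | hκ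
  · simp
  have hc : 0 < κ ^ (-(1 / a)) := Real.rpow_pos_of_pos hκ _
  have := (integrableOn_Ioi_comp_mul_left_iff (fun v : ℝ => 1 / (1 + v ^ a)) 0 hc).2
    (by simpa using integrableOn_one_div_one_add_rpow ha)
  refine this.congr_fun (fun w hw => ?_) measurableSet_Ioi
  exact (div_rpow_add_eq (by linarith) hκ (le_of_lt hw)).symm

lemma setIntegral_div_rpow_add {a κ t : ℝ} (ha : 0 < a) (hκ : 0 < κ) (ht : 0 ≤ t) :
    ∫ w in Ioi t, κ / (w ^ a + κ)
      = κ ^ (1 / a) * ∫ v in Ioi (κ ^ (-(1 / a)) * t), 1 / (1 + v ^ a) := by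
  have hc : 0 < κ ^ (-(1 / a)) := Real.rpow_pos_of_pos hκ _
  have h := integral_comp_mul_left_Ioi (fun v : ℝ => 1 / (1 + v ^ a)) t hc
  rw [← Real.rpow_neg hκ.le, neg_neg, smul_eq_mul] at h
  rw [← h]
  exact setIntegral_congr_fun measurableSet_Ioi fun w hw =>
    div_rpow_add_eq ha hκ (ht.trans (le_of_lt hw))

/-! ### The transmit power of a buyer -/

namespace IsUserField

variable {Ω : Type*} [MeasurableSpace Ω] {Y : ℕ → Ω → Plane} {g : ℕ → Ω → ℝ} {r : ℝ≥0}
  {P : Measure Ω}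

lemma isMarkedPoisson [IsProbabilityMeasure P] (h : IsUserField Y g r P) :
    IsMarkedPoisson (fun _ : Unit => Y) (fun _ => g) (fun _ => r) (fun _ => expMeasure 1) P where
  poisson _ := h.poisson
  indep := iIndepFun.of_subsingleton
  mark_measurable _ := h.gain_measurable
  mark_law _ n := (h.gain_law n).map_eq
  mark_indep := h.gain_indep.precomp (g := Prod.snd) fun i j hij => Prod.ext rfl hij
  indep_mark := h.indep.comp (φ := fun (y : ℕ → Plane) (i : Unit × ℕ) => y i.2)
    (ψ := fun (y : ℕ → ℝ) (i : Unit × ℕ) => y i.2) (by fun_prop) (by fun_prop)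

lemma measurable_largestGain (h : IsUserField Y g r P) (α : ℝ) (x : Plane) :
    Measurable (largestGain α x Y g) := by
  have h1 := h.poisson.measurable
  have h2 := h.gain_measurable
  unfold largestGain
  fun_prop

lemma measurable_maxPower (h : IsUserField Y g r P) (α ζ : ℝ) (x : Plane) :
    Measurable (maxPower α ζ x Y g) := by
  have := h.measurable_largestGain α x
  unfold maxPower
  fun_prop

/-- A void probability: no user may have gain exceeding `s ‖x - y‖^α`, and the mean number of such
users is `r ∫ e^{-s|y|^α} dy = r π Γ(1 + 2/α) s^{-2/α}`. Writing the level as `s = u^(-α/2)` makes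
this linear in `u`. -/
lemma measure_largestGain_le [IsProbabilityMeasure P] (h : IsUserField Y g r P) {α : ℝ} (hα : 0 < α) (x : Plane) {u : ℝ}
    (hu : 0 < u) :
    P {ω | largestGain α x Y g ω ≤ ENNReal.ofReal (u ^ (-(α / 2)))}
      = nexp (ENNReal.ofReal (r * Real.pi * Real.Gamma (1 / (α / 2) + 1) * u)) := by
  set s := u ^ (-(α / 2)) with hs
  have hs0 : 0 < s := Real.rpow_pos_of_pos hu _
  set f : Plane × ℝ → ℝ≥0∞ := fun p =>
    if ENNReal.ofReal (p.2 * ‖x - p.1‖ ^ (-α)) ≤ ENNReal.ofReal s then 0 else ∞ with hf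
  have hset : MeasurableSet {p : Plane × ℝ |
      ENNReal.ofReal (p.2 * ‖x - p.1‖ ^ (-α)) ≤ ENNReal.ofReal s} :=
    measurableSet_le (by fun_prop) measurable_const
  have hfm : Measurable f := Measurable.ite hset measurable_const measurable_const
  have hmH : MeasurableSet {ω | largestGain α x Y g ω ≤ ENNReal.ofReal s} :=
    measurableSet_le (h.measurable_largestGain α x) measurable_const
  have hL : ∀ ω, nexp (∑' n, f (Y n ω, g n ω))
      = {ω | largestGain α x Y g ω ≤ ENNReal.ofReal s}.indicator 1 ω := fun ω => by
    by_cases hω : largestGain α x Y g ω ≤ ENNReal.ofReal s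
    · rw [indicator_of_mem (by exact hω)]
      have : ∀ n, f (Y n ω, g n ω) = 0 := fun n => by
        simp only [hf]
        rw [if_pos]
        exact (le_iSup (fun i => ENNReal.ofReal (g i ω * ‖x - Y i ω‖ ^ (-α))) n).trans hω
      simp [this]
    · rw [indicator_of_notMem (by exact hω)]
      obtain ⟨n, hn⟩ : ∃ n, ¬ ENNReal.ofReal (g n ω * ‖x - Y n ω‖ ^ (-α)) ≤ ENNReal.ofReal s := by
        by_contra! hcon
        exact hω (iSup_le hcon)
      rw [nexp_eq_zero_iff]
      refine ENNReal.tsum_eq_top_of_eq_top ⟨n, ?_⟩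
      simp only [hf]
      rw [if_neg hn]
  have hmain := h.isMarkedPoisson.laplace_single () hfm
  simp_rw [hL] at hmain
  rw [lintegral_indicator_one hmH] at hmain
  rw [hmain]
  have hin : ∀ᵐ y : Plane, ∫⁻ e, 1 - nexp (f (y, e)) ∂(expMeasure 1)
      = ENNReal.ofReal (Real.exp (-s * (‖x - y‖ ^ 2) ^ (α / 2))) := by
    have hx : ∀ᵐ y : Plane, y ≠ x := by
      simp [ae_iff]
    filter_upwards [hx] with y hy
    have hd : 0 < ‖x - y‖ := norm_pos_iff.2 (sub_ne_zero.2 hy.symm)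
    have hpw : 0 < ‖x - y‖ ^ α := Real.rpow_pos_of_pos hd _
    have h1 : ∀ e, 1 - nexp (f (y, e))
        = {e | ENNReal.ofReal (s * ‖x - y‖ ^ α) < ENNReal.ofReal e}.indicator 1 e := fun e => by
      have hiff : ENNReal.ofReal (e * ‖x - y‖ ^ (-α)) ≤ ENNReal.ofReal s
          ↔ ¬ ENNReal.ofReal (s * ‖x - y‖ ^ α) < ENNReal.ofReal e := by
        rw [not_lt, ENNReal.ofReal_le_ofReal_iff hs0.le,
          ENNReal.ofReal_le_ofReal_iff (by positivity), Real.rpow_neg hd.le, ← div_eq_mul_inv,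
          div_le_iff₀ hpw]
      by_cases he : ENNReal.ofReal (s * ‖x - y‖ ^ α) < ENNReal.ofReal e
      · rw [indicator_of_mem (by exact he)]
        simp only [hf]
        rw [if_neg (fun hc => hiff.1 hc he)]
        simp
      · rw [indicator_of_notMem (by exact he)]
        simp only [hf]
        rw [if_pos (hiff.2 he)]
        simp
    simp_rw [h1]
    rw [lintegral_indicator_one (measurableSet_lt measurable_const (by fun_prop)),
      expMeasure_lt_ofReal, nexp_ofReal (by positivity), ← Real.rpow_natCast, ← Real.rpow_mul hd.le]
    congr 3
    rw [neg_mul]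
    congr 3
    push_cast; ring
  -- Translation invariance removes `x` from the law.
  rw [lintegral_congr_ae hin, lintegral_sub_left_eq_self
      (fun y : Plane => ENNReal.ofReal (Real.exp (-s * (‖y‖ ^ 2) ^ (α / 2)))) x,
    lintegral_norm_sq (φ := fun u => ENNReal.ofReal (Real.exp (-s * u ^ (α / 2)))) (by fun_prop)]
  have hint := integral_exp_neg_mul_rpow (p := α / 2) (by positivity) hs0
  -- The integral has a positive value, whereas that of a non-integrable function is `0` by
  -- convention.
  have hintb : IntegrableOn (fun u : ℝ => Real.exp (-s * u ^ (α / 2))) (Ioi 0) := by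
    by_contra hcon
    rw [integral_undef hcon] at hint
    have : 0 < Real.Gamma (1 / (α / 2) + 1) := Real.Gamma_pos_of_pos (by positivity)
    have h3 : 0 < s ^ (-1 / (α / 2)) := Real.rpow_pos_of_pos hs0 _
    exact (mul_pos h3 this).ne hint
  rw [← ofReal_integral_eq_lintegral_ofReal hintb (.of_forall fun u => Real.exp_nonneg _), hint]
  have hsu : s ^ (-1 / (α / 2)) = u := by
    rw [hs, ← Real.rpow_mul hu.le]
    have : -(α / 2) * (-1 / (α / 2)) = 1 := by field_simp
    rw [this, Real.rpow_one]
  rw [hsu, ← ENNReal.ofReal_mul Real.pi_nonneg, ← ENNReal.ofReal_coe_nnreal,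
    ← ENNReal.ofReal_mul r.coe_nonneg]
  congr 2; ring

variable [IsProbabilityMeasure P] {α : ℝ}

/-- The level `u^(-α/2)` tends to `0` as `u → ∞`, and the void probability decays because the
intensity is positive. -/
lemma ae_largestGain_ne_zero (h : IsUserField Y g r P) (hr : 0 < r) (hα : 0 < α) (x : Plane) : ∀ᵐ ω ∂P, largestGain α x Y g ω ≠ 0 := by
  have hK : 0 < r * Real.pi * Real.Gamma (1 / (α / 2) + 1) := by
    have : 0 < Real.Gamma (1 / (α / 2) + 1) := Real.Gamma_pos_of_pos (by positivity)
    have := Real.pi_pos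
    positivity
  have hlim : Filter.Tendsto
      (fun u : ℝ => nexp (ENNReal.ofReal (r * Real.pi * Real.Gamma (1 / (α / 2) + 1) * u)))
      Filter.atTop (nhds 0) := by
    rw [← nexp_top]
    exact (continuous_nexp.tendsto _).comp (ENNReal.tendsto_ofReal_atTop.comp
      (Filter.tendsto_id.const_mul_atTop hK))
  rw [ae_iff]
  refine le_antisymm (ge_of_tendsto hlim ?_) zero_le
  filter_upwards [Filter.eventually_gt_atTop 0] with u hu
  rw [← h.measure_largestGain_le hα x hu]
  refine measure_mono fun ω hω => ?_
  simp only [mem_ofPred_eq, not_not] at hω ⊢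
  rw [hω]
  exact zero_le

/-- The void probability tends to `1` as `u ↓ 0`. -/
lemma ae_largestGain_ne_top (h : IsUserField Y g r P) (hα : 0 < α) (x : Plane) : ∀ᵐ ω ∂P, largestGain α x Y g ω ≠ ∞ := by
  have hlim : Filter.Tendsto
      (fun u : ℝ => nexp (ENNReal.ofReal (r * Real.pi * Real.Gamma (1 / (α / 2) + 1) * u)))
      (nhdsWithin 0 (Ioi 0)) (nhds 1) := by
    have hc : Continuous
        (fun u : ℝ => nexp (ENNReal.ofReal (r * Real.pi * Real.Gamma (1 / (α / 2) + 1) * u))) :=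
      continuous_nexp.comp (ENNReal.continuous_ofReal.comp (by fun_prop))
    have := hc.tendsto 0
    simp only [mul_zero, ENNReal.ofReal_zero, nexp_zero] at this
    exact this.mono_left nhdsWithin_le_nhds
  refine (prob_compl_eq_zero_iff
    ((h.measurable_largestGain α x) (measurableSet_singleton ∞)).compl).2 ?_
  refine le_antisymm prob_le_one (le_of_tendsto hlim ?_)
  filter_upwards [self_mem_nhdsWithin] with u hu
  rw [← h.measure_largestGain_le hα x hu]
  refine measure_mono fun ω hω => ?_
  simp only [mem_ofPred_eq, mem_compl_iff, mem_preimage, mem_singleton_iff] at hω ⊢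
  exact (hω.trans_lt ENNReal.ofReal_lt_top).ne

lemma ae_maxPower_pos (h : IsUserField Y g r P) (hr : 0 < r) (hα : 0 < α) (x : Plane)
    {ζ : ℝ} (hζ : 0 < ζ) : ∀ᵐ ω ∂P, 0 < maxPower α ζ x Y g ω := by
  filter_upwards [h.ae_largestGain_ne_zero hr hα x, h.ae_largestGain_ne_top hα x] with ω h0 h1
  refine ENNReal.toReal_pos ?_ ?_
  · exact (ENNReal.div_pos (by simpa using hζ) h1).ne'
  · exact ENNReal.div_ne_top ENNReal.ofReal_ne_top h0

/-- `H^{-2/α}` has an exponential tail, hence so has the power raised to `2/α`; the layer-cake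
formula concludes. -/
lemma integrable_maxPower_rpow (h : IsUserField Y g r P) (hr : 0 < r) (hα : 0 < α) (x : Plane)
    {ζ : ℝ} (hζ : 0 < ζ) :
    Integrable (fun ω => maxPower α ζ x Y g ω ^ (2 / α)) P := by
  have hm : Measurable (fun ω => maxPower α ζ x Y g ω ^ (2 / α)) :=
    (h.measurable_maxPower α ζ x).pow_const _
  have hnn : ∀ ω, 0 ≤ maxPower α ζ x Y g ω ^ (2 / α) := fun ω =>
    Real.rpow_nonneg ENNReal.toReal_nonneg _
  refine ⟨hm.aestronglyMeasurable, ?_⟩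
  rw [hasFiniteIntegral_iff_ofReal (.of_forall hnn),
    lintegral_eq_lintegral_meas_le P (.of_forall hnn) hm.aemeasurable]
  set K := r * Real.pi * Real.Gamma (1 / (α / 2) + 1) * ζ ^ (-(2 / α)) with hKdef
  have hK : 0 < K := by
    have : 0 < Real.Gamma (1 / (α / 2) + 1) := Real.Gamma_pos_of_pos (by positivity)
    have := Real.pi_pos
    positivity
  have hbound : ∀ t ∈ Ioi (0 : ℝ), P {ω | t ≤ maxPower α ζ x Y g ω ^ (2 / α)}
      ≤ ENNReal.ofReal (Real.exp (-K * t)) := fun t ht => by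
    have ht : 0 < t := ht
    have hu : 0 < ζ ^ (-(2 / α)) * t := by positivity
    have hval : (ζ ^ (-(2 / α)) * t) ^ (-(α / 2)) = ζ / t ^ (α / 2) := by
      have : -(2 / α) * -(α / 2) = 1 := by field_simp
      rw [Real.mul_rpow (by positivity) ht.le, ← Real.rpow_mul hζ.le, Real.rpow_neg ht.le, this, Real.rpow_one]
      exact (div_eq_mul_inv _ _).symm
    have := h.measure_largestGain_le hα x hu
    rw [← mul_assoc, ← hKdef, nexp_ofReal (by positivity), ← neg_mul] at this
    rw [← this, hval]
    refine measure_mono fun ω hω => ?_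
    simp only [mem_ofPred_eq] at hω ⊢
    have htp : 0 < t ^ (α / 2) := Real.rpow_pos_of_pos ht _
    have h1 : t ^ (α / 2) ≤ maxPower α ζ x Y g ω := by
      have := Real.rpow_le_rpow ht.le hω (by positivity : 0 ≤ α / 2)
      rw [← Real.rpow_mul (x := maxPower α ζ x Y g ω) ENNReal.toReal_nonneg] at this
      have h2 : 2 / α * (α / 2) = 1 := by field_simp
      rwa [h2, Real.rpow_one] at this
    have h3 : ENNReal.ofReal (t ^ (α / 2)) ≤ ENNReal.ofReal ζ / largestGain α x Y g ω :=
      (ENNReal.ofReal_le_ofReal h1).trans ENNReal.ofReal_toReal_le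
    rw [ENNReal.ofReal_div_of_pos htp, ENNReal.le_div_iff_mul_le
      (Or.inl (by simpa using htp)) (Or.inl ENNReal.ofReal_ne_top), mul_comm]
    exact ENNReal.mul_le_of_le_div h3
  refine (setLIntegral_mono (by fun_prop) hbound).trans_lt ?_
  have := (integrableOn_exp_mul_Ioi (neg_lt_zero.2 hK) 0).2
  rwa [hasFiniteIntegral_iff_ofReal (.of_forall fun _ => Real.exp_nonneg _)] at this

end IsUserField

/-! ### Independence of families of random variables -/

section Independence

variable {Ω β γ δ I J : Type*} [MeasurableSpace Ω] [MeasurableSpace β] [MeasurableSpace γ]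
  [MeasurableSpace δ] {P : Measure Ω}

/-- Preimages under a constant are empty or everything: in the first case both sides vanish,
otherwise the constant drops out. It serves to add the fixed power of the seller to the independent
powers of the buyers. -/
lemma iIndepFun_of_const_off_range [IsProbabilityMeasure P] {e : J → I}
    (he : Function.Injective e) {u : I → Ω → β} (hJ : iIndepFun (fun j => u (e j)) P)
    (hc : ∀ i ∉ range e, ∃ c, u i = fun _ => c) : iIndepFun u P := by
  classical
  rw [iIndepFun_iff_measure_inter_preimage_eq_mul] at hJ ⊢
  intro S B hB
  by_cases hempty : ∃ i ∈ S, i ∉ range e ∧ u i ⁻¹' B i = ∅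
  · obtain ⟨i, hiS, _, hi⟩ := hempty
    rw [Finset.prod_eq_zero hiS (by rw [hi, measure_empty])]
    refine measure_mono_null (fun ω hω => ?_) (measure_empty (μ := P))
    rw [← hi]
    exact mem_iInter₂.1 hω i hiS
  have huniv : ∀ i ∈ S, i ∉ range e → u i ⁻¹' B i = univ := fun i hi hir => by
    obtain ⟨c, hcc⟩ := hc i hir
    by_cases hcB : c ∈ B i
    · rw [hcc]; simp [hcB]
    · exact absurd ⟨i, hi, hir, by rw [hcc]; simp [hcB]⟩ hempty
  have h1 := hJ (S.preimage e he.injOn) (sets := fun j => B (e j))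
    (fun j hj => hB _ (Finset.mem_preimage.1 hj))
  rw [Finset.prod_preimage e S he.injOn (fun i => P (u i ⁻¹' B i)) (fun i hi hir => by
    rw [huniv i hi hir, measure_univ])] at h1
  rw [← h1]
  congr 1
  ext ω
  simp only [mem_iInter, Finset.mem_preimage]
  refine ⟨fun h j hj => h _ hj, fun h i hi => ?_⟩
  by_cases hir : i ∈ range e
  · obtain ⟨j, rfl⟩ := hir
    exact h j hi
  · rw [huniv i hi hir]
    trivial

/-- Measurable rectangles form a π-system that generates the product σ-algebra. On rectangles the
`u` part and the `v` part separate first, and then each part factors. -/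
lemma iIndepFun_prodMk_of_indepFun [IsProbabilityMeasure P] {u : I → Ω → β} {v : I → Ω → γ}
    (hum : ∀ i, Measurable (u i)) (hvm : ∀ i, Measurable (v i)) (hu : iIndepFun u P)
    (hv : iIndepFun v P) (huv : IndepFun (fun ω i => u i ω) (fun ω i => v i ω) P) :
    iIndepFun (fun i ω => (u i ω, v i ω)) P := by
  rw [iIndepFun_iff_iIndep]
  refine iIndepSets.iIndep (fun i => ((hum i).prodMk (hvm i)).comap_le)
    (fun i => {s | ∃ t ∈ image2 (· ×ˢ ·) {s : Set β | MeasurableSet s} {t : Set γ | MeasurableSet t},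
      (fun ω => (u i ω, v i ω)) ⁻¹' t = s})
    (fun i => isPiSystem_prod.comap _) (fun i => ?_) ?_
  · rw [← generateFrom_prod, MeasurableSpace.comap_generateFrom]
    rfl
  · rw [iIndepSets_iff]
    intro S f hf
    have : ∀ i, ∃ A : Set β, ∃ B : Set γ, i ∈ S →
        MeasurableSet A ∧ MeasurableSet B ∧ f i = u i ⁻¹' A ∩ v i ⁻¹' B := fun i => by
      by_cases hi : i ∈ S
      · obtain ⟨_, ⟨A, hA, B, hB, rfl⟩, hAB⟩ := hf i hi
        exact ⟨A, B, fun _ => ⟨hA, hB, hAB.symm⟩⟩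
      · exact ⟨∅, ∅, fun h => absurd h hi⟩
    choose A B hAB using this
    have hU : (⋂ i ∈ S, f i) = (fun ω i => u i ω) ⁻¹' (⋂ i ∈ S, (fun a => a i) ⁻¹' A i)
        ∩ (fun ω i => v i ω) ⁻¹' (⋂ i ∈ S, (fun a => a i) ⁻¹' B i) := by
      ext ω
      simp only [mem_iInter, mem_inter_iff, mem_preimage]
      constructor
      · intro h
        refine ⟨fun i hi => ?_, fun i hi => ?_⟩ <;>
        · have := h i hi
          rw [(hAB i hi).2.2] at this
          first | exact this.1 | exact this.2
      · intro h i hi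
        rw [(hAB i hi).2.2]
        exact ⟨h.1 i hi, h.2 i hi⟩
    have hprod : ∏ i ∈ S, P (f i) = (∏ i ∈ S, P (u i ⁻¹' A i)) * ∏ i ∈ S, P (v i ⁻¹' B i) := by
      rw [← Finset.prod_mul_distrib]
      refine Finset.prod_congr rfl fun i hi => ?_
      rw [(hAB i hi).2.2]
      exact ((huv.comp (measurable_pi_apply i) (measurable_pi_apply i)).measure_inter_preimage_eq_mul
        _ _ (hAB i hi).1 (hAB i hi).2.1)
    rw [hU, huv.measure_inter_preimage_eq_mul _ _
      (Finset.measurableSet_biInter _ fun i hi => measurable_pi_apply i (hAB i hi).1)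
      (Finset.measurableSet_biInter _ fun i hi => measurable_pi_apply i (hAB i hi).2.1), hprod]
    rw [iIndepFun_iff_measure_inter_preimage_eq_mul] at hu hv
    rw [← hu S fun i hi => (hAB i hi).1, ← hv S fun i hi => (hAB i hi).2.1]
    congr 2 <;> (ext ω; simp)

/-- The joint law is a triple product measure, and products of measures are associative. -/
lemma IndepFun.prodMk_right_of_prodMk_left [IsProbabilityMeasure P] {a : Ω → β} {b : Ω → γ}
    {c : Ω → δ} (ha : Measurable a) (hb : Measurable b) (hc : Measurable c) (hab : IndepFun a b P)
    (habc : IndepFun (fun ω => (a ω, b ω)) c P) : IndepFun a (fun ω => (b ω, c ω)) P := by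
  have hbc : IndepFun b c P := habc.comp measurable_snd measurable_id
  have : IsProbabilityMeasure (P.map a) := Measure.isProbabilityMeasure_map ha.aemeasurable
  have : IsProbabilityMeasure (P.map b) := Measure.isProbabilityMeasure_map hb.aemeasurable
  have : IsProbabilityMeasure (P.map c) := Measure.isProbabilityMeasure_map hc.aemeasurable
  rw [indepFun_iff_map_prod_eq_prod_map_map ha.aemeasurable (hb.prodMk hc).aemeasurable,
    hbc.map_prod_eq_prod_map_map hb.aemeasurable hc.aemeasurable,
    ← (measurePreserving_prodAssoc _ _ _).map_eq,
    ← hab.map_prod_eq_prod_map_map ha.aemeasurable hb.aemeasurable,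
    ← habc.map_prod_eq_prod_map_map (ha.prodMk hb).aemeasurable hc.aemeasurable,
    Measure.map_map (by fun_prop) (by fun_prop)]
  rfl

lemma iIndepFun.indepFun_ne {u : I → Ω → β} (hum : ∀ i, Measurable (u i)) (hu : iIndepFun u P)
    (i₀ : I) : IndepFun (u i₀) (fun ω (i : {i // i ≠ i₀}) => u i ω) P := by
  rw [iIndepFun_iff_iIndep] at hu
  have h := indep_iSup_of_disjoint (fun i => (hum i).comap_le) hu
    (S := {i₀}) (T := {i | i ≠ i₀}) (by simp)
  rw [IndepFun_iff_Indep]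
  convert h using 1
  · simp
  · rw [MeasurableSpace.pi, MeasurableSpace.comap_iSup, iSup_subtype]
    simp_rw [MeasurableSpace.comap_comp]
    rfl

/-- If a random index `N` selects a member of an i.i.d. family `h`, and if on `N = n` a random
variable `W` is a function of data independent of `h n`, then `h N` is independent of `W` and has
the common law of the `h n`. -/
lemma lintegral_selected [IsProbabilityMeasure P] {N : Ω → ℕ} {h : ℕ → Ω → β} {W : Ω → γ}
    {V : ℕ → Ω → δ} {Wn : ℕ → Ω → γ} {μ : Measure β}
    [IsProbabilityMeasure μ] (hN : ∀ n, MeasurableSet[MeasurableSpace.comap (V n) inferInstance]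
      {ω | N ω = n})
    (hW : ∀ n, Measurable[MeasurableSpace.comap (V n) inferInstance] (Wn n))
    (hWn : ∀ ω, W ω = Wn (N ω) ω) (hh : ∀ n, Measurable (h n)) (hV : ∀ n, Measurable (V n))
    (hlaw : ∀ n, P.map (h n) = μ) (hind : ∀ n, IndepFun (h n) (V n) P)
    {g : β × γ → ℝ≥0∞} (hg : Measurable g) :
    ∫⁻ ω, g (h (N ω) ω, W ω) ∂P = ∫⁻ ω, ∫⁻ x, g (x, W ω) ∂μ ∂P := by
  have hNm : ∀ n, MeasurableSet {ω | N ω = n} := fun n => (hV n).comap_le _ (hN n)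
  have hsplit : ∀ F : Ω → ℝ≥0∞, ∫⁻ ω, F ω ∂P
      = ∑' n, ∫⁻ ω, {ω | N ω = n}.indicator F ω ∂P := fun F => by
    have hU : (⋃ n, {ω | N ω = n}) = univ := by ext ω; simp
    rw [← setLIntegral_univ, ← hU, lintegral_iUnion hNm]
    · simp_rw [lintegral_indicator (hNm _)]
    · intro i j hij
      refine Set.disjoint_left.2 fun ω hi hj => hij ?_
      exact hi.symm.trans hj
  rw [hsplit, hsplit]
  refine tsum_congr fun n => ?_
  obtain ⟨A, hA, hAN⟩ := hN n
  -- The selection event is carried along as a `Prop`-valued coordinate, so that it and `Wn n` form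
  -- a single variable independent of `h n`.
  set Q : Ω → γ × Prop := fun ω => (Wn n ω, N ω = n) with hQ
  have hQm : Measurable[MeasurableSpace.comap (V n) inferInstance] Q :=
    (hW n).prodMk (measurable_to_prop (by
      convert hN n using 1
      ext ω
      simp))
  have hQind : IndepFun (h n) Q P := by
    rw [IndepFun_iff_Indep]
    exact indep_of_indep_of_le_right ((IndepFun_iff_Indep _ _ _).1 (hind n)) hQm.comap_le
  have hQm' : Measurable Q := hQm.mono (hV n).comap_le le_rfl
  set G : β × (γ × Prop) → ℝ≥0∞ := fun p =>
    {p : β × (γ × Prop) | p.2.2}.indicator (fun p => g (p.1, p.2.1)) p with hG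
  have hGm : Measurable G := by
    refine Measurable.indicator (by fun_prop) ?_
    exact measurableSet_setOfPred.2 (by fun_prop)
  have h1 : ∀ ω, {ω | N ω = n}.indicator (fun ω => g (h (N ω) ω, W ω)) ω = G (h n ω, Q ω) := by
    intro ω
    by_cases hω : N ω = n
    · rw [indicator_of_mem (by exact hω)]
      simp only [hG, hQ]
      rw [indicator_of_mem (by exact hω), hWn, hω]
    · rw [indicator_of_notMem (by exact hω)]
      simp only [hG, hQ]
      rw [indicator_of_notMem (by exact hω)]
  have h2 : ∀ ω, {ω | N ω = n}.indicator (fun ω => ∫⁻ x, g (x, W ω) ∂μ) ω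
      = ∫⁻ x, G (x, Q ω) ∂μ := by
    intro ω
    by_cases hω : N ω = n
    · rw [indicator_of_mem (by exact hω)]
      refine lintegral_congr fun x => ?_
      simp only [hG, hQ]
      rw [indicator_of_mem (by exact hω), hWn, hω]
    · rw [indicator_of_notMem (by exact hω)]
      simp only [hG, hQ]
      simp [hω]
  simp_rw [h1, h2]
  rw [← lintegral_map (f := G) (g := fun ω => (h n ω, Q ω)) hGm ((hh n).prodMk hQm'),
    hQind.map_prod_eq_prod_map_map (hh n).aemeasurable hQm'.aemeasurable, hlaw,
    lintegral_prod_symm' _ hGm, lintegral_map (by fun_prop) hQm']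

end Independence

/-! ### The contribution of one operator to the Laplace exponent -/

/-- Exponent of the Laplace functional of one operator, per unit of intensity: it accounts for the
absence of base stations with path loss variable at most `t`, and for the received power. -/
def gapIntegral (a κ t : ℝ) : ℝ := t + ∫ w in Ioi t, κ / (w ^ a + κ)

lemma gapIntegral_nonneg {a κ t : ℝ} (hκ : 0 ≤ κ) (ht : 0 ≤ t) : 0 ≤ gapIntegral a κ t :=
  add_nonneg ht (setIntegral_nonneg measurableSet_Ioi fun w hw => by
    have := Real.rpow_nonneg (ht.trans (le_of_lt hw)) a
    positivity)

/-- The `max` admits negative `t`, which encodes an operator without excluded stations. -/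
lemma setLIntegral_gap {a κ : ℝ} (ha : 1 < a) (hκ : 0 ≤ κ) (t : ℝ) :
    ∫⁻ w in Ioi (0 : ℝ), (if w ≤ t then 1 else ENNReal.ofReal (κ / (w ^ a + κ)))
      = ENNReal.ofReal (gapIntegral a κ (max t 0)) := by
  set t' := max t 0 with ht'
  have ht0 : 0 ≤ t' := le_max_right _ _
  have h1 : ∀ w ∈ Ioi (0 : ℝ), (if w ≤ t then 1 else ENNReal.ofReal (κ / (w ^ a + κ)))
      = (if w ≤ t' then 1 else ENNReal.ofReal (κ / (w ^ a + κ))) := fun w hw => by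
    have : w ≤ t ↔ w ≤ t' := by
      have hw : 0 < w := hw
      simp [ht', hw]
    simp only [this]
  have hnn : ∀ w ∈ Ioi t', 0 ≤ κ / (w ^ a + κ) := fun w hw => by
    have := Real.rpow_nonneg (ht0.trans (le_of_lt hw)) a
    positivity
  rw [setLIntegral_congr_fun measurableSet_Ioi h1, ← Ioc_union_Ioi_eq_Ioi ht0,
    lintegral_union measurableSet_Ioi Ioc_disjoint_Ioi_same,
    setLIntegral_congr_fun (g := fun _ => 1) measurableSet_Ioc (fun w hw => if_pos hw.2),
    setLIntegral_congr_fun (g := fun w => ENNReal.ofReal (κ / (w ^ a + κ))) measurableSet_Ioi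
      (fun w hw => if_neg (not_le.2 hw)),
    ← ofReal_integral_eq_lintegral_ofReal
      ((integrableOn_div_rpow_add ha hκ).mono_set (Ioi_subset_Ioi ht0))
      ((ae_restrict_mem measurableSet_Ioi).mono hnn), setLIntegral_one, Real.volume_Ioc, sub_zero,
    gapIntegral, ENNReal.ofReal_add ht0 (setIntegral_nonneg measurableSet_Ioi hnn)]

/-- The cost attached to a base station at `x` with gain `h` and power `p`: infinite if its path
loss variable is at most `t`, and `κ` times its received power otherwise. -/
def bsCost (α κ t : ℝ) (q : Plane × (ℝ × ℝ)) : ℝ≥0∞ :=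
  (if ‖q.1‖ ^ 2 / q.2.2 ^ (2 / α) ≤ t then ∞ else 0)
    + ENNReal.ofReal (κ * (q.2.2 * q.2.1 * ‖q.1‖ ^ (-α)))

@[fun_prop]
lemma measurable_bsCost (α κ t : ℝ) : Measurable (bsCost α κ t) := by
  refine Measurable.add (Measurable.ite (measurableSet_le ?_ measurable_const) measurable_const
    measurable_const) ?_ <;> fun_prop

lemma pathLoss_rpow {α x p : ℝ} (hα : 0 < α) (hx : 0 < x) (hp : 0 < p) :
    (x ^ 2 / p ^ (2 / α)) ^ (α / 2) = x ^ α / p := by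
  rw [Real.div_rpow (by positivity) (by positivity), ← Real.rpow_natCast, ← Real.rpow_mul hx.le,
    ← Real.rpow_mul hp.le]
  have h1 : ((2 : ℕ) : ℝ) * (α / 2) = α := by push_cast; ring
  have h2 : 2 / α * (α / 2) = 1 := by field_simp
  rw [h1, h2, Real.rpow_one]

/-- Averaging over the gain gives `1 - 1/(1 + κ p |x|^(-α)) = κ/(w^(α/2) + κ)`, a function of the
path loss variable `w = |x|²/p^(2/α)` only. For fixed `p` this variable has intensity `π p^(2/α)
dw`, so the power law enters through its moment `m` alone. -/
lemma lintegral_bsCost {α κ : ℝ} (hα : 2 < α) (hκ : 0 ≤ κ) (t : ℝ) (τ : Measure ℝ)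
    [IsProbabilityMeasure τ] (hτ : ∀ᵐ p ∂τ, 0 < p) {m : ℝ}
    (hm : ∫⁻ p, ENNReal.ofReal (p ^ (2 / α)) ∂τ = ENNReal.ofReal m) :
    ∫⁻ x, ∫⁻ e, 1 - nexp (bsCost α κ t (x, e)) ∂((expMeasure 1).prod τ)
      = ENNReal.ofReal (Real.pi * m * gapIntegral (α / 2) κ (max t 0)) := by
  have hα0 : 0 < α := by linarith
  set φ : ℝ → ℝ≥0∞ := fun w => if w ≤ t then 1 else ENNReal.ofReal (κ / (w ^ (α / 2) + κ)) with hφ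
  have hφm : Measurable φ := by
    refine Measurable.ite (measurableSet_le measurable_id measurable_const) measurable_const ?_
    fun_prop
  have hin : ∀ᵐ x : Plane, ∫⁻ e, 1 - nexp (bsCost α κ t (x, e)) ∂((expMeasure 1).prod τ)
      = ∫⁻ p, φ (‖x‖ ^ 2 / p ^ (2 / α)) ∂τ := by
    have hx : ∀ᵐ y : Plane, y ≠ 0 := by simp [ae_iff]
    filter_upwards [hx] with x hx
    have hd : 0 < ‖x‖ := norm_pos_iff.2 hx
    rw [lintegral_prod_symm' _ (by fun_prop)]
    refine lintegral_congr_ae ?_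
    filter_upwards [hτ] with p hp
    by_cases hw : ‖x‖ ^ 2 / p ^ (2 / α) ≤ t
    · simp [bsCost, hφ, hw]
    · have hpw : 0 < ‖x‖ ^ α := Real.rpow_pos_of_pos hd _
      set s := κ * p * ‖x‖ ^ (-α) with hs
      have hs0 : 0 ≤ s := by positivity
      have h1 : ∀ h, 1 - nexp (bsCost α κ t (x, (h, p))) = 1 - nexp (ENNReal.ofReal (s * h)) := by
        intro h
        simp only [bsCost, hw, if_false, zero_add, hs]
        congr 3; ring
      simp_rw [h1]
      rw [lintegral_sub (f := fun _ => 1) (g := fun h => nexp (ENNReal.ofReal (s * h)))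
        (by fun_prop) (by rw [lintegral_nexp_mul_expMeasure hs0]; exact ENNReal.ofReal_ne_top)
        (.of_forall fun h => nexp_le_one _), lintegral_nexp_mul_expMeasure hs0, lintegral_const,
        measure_univ, mul_one, ← ENNReal.ofReal_one, ← ENNReal.ofReal_sub _ (by positivity)]
      simp only [hφ, hw, if_false]
      congr 1
      rw [pathLoss_rpow hα0 hd hp, hs, Real.rpow_neg hd.le]
      have : 0 < ‖x‖ ^ α / p := by positivity
      field_simp
      ring
  rw [lintegral_congr_ae hin, lintegral_lintegral_swap (by fun_prop)]
  have hout : ∀ᵐ p ∂τ, ∫⁻ x : Plane, φ (‖x‖ ^ 2 / p ^ (2 / α))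
      = ENNReal.ofReal (p ^ (2 / α)) * (ENNReal.ofReal Real.pi * ∫⁻ u in Ioi (0 : ℝ), φ u) := by
    filter_upwards [hτ] with p hp
    rw [lintegral_norm_sq_div hφm (Real.rpow_pos_of_pos hp _)]
    ring
  rw [lintegral_congr_ae hout, lintegral_mul_const _ (by fun_prop), hm,
    setLIntegral_gap (by linarith) hκ, mul_comm Real.pi, mul_assoc,
    ENNReal.ofReal_mul' (mul_nonneg Real.pi_nonneg (gapIntegral_nonneg hκ (le_max_right _ _))),
    ENNReal.ofReal_mul Real.pi_nonneg]

/-! ### The base stations of all operators as a marked Poisson process -/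

namespace Downlink

variable {O Ω : Type*} [DecidableEq O] (D : Downlink O Ω)

/-- Transmit power of the `n`-th base station of operator `k`. -/
def txPower (k : O) (n : ℕ) (ω : Ω) : ℝ := if k = D.seller then D.sellerPower else D.power k n ω

/-- Law of the transmit power of the base stations of operator `k`. -/
def txLaw (powerLaw : Measure ℝ) (k : O) : Measure ℝ :=
  if k = D.seller then Measure.dirac D.sellerPower else powerLaw

/-- Moment of order `2/α` of the transmit power of the base stations of operator `k`. -/
def txMoment (M : ℝ) (k : O) : ℝ := if k = D.seller then D.sellerPower ^ (2 / D.α) else M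

/-- The gain and the transmit power of the `n`-th base station of operator `k`. -/
def mark (k : O) (n : ℕ) (ω : Ω) : ℝ × ℝ := (D.gain k n ω, D.txPower k n ω)

/-- Independence statements about the powers of the buyers carry over to all operators along this
measurable map. -/
lemma exists_measurable_txPower (D : Downlink O Ω) :
    ∃ Φ : (({k // k ∈ D.group.erase D.seller} × ℕ) → ℝ) → (D.group × ℕ) → ℝ, Measurable Φ ∧
      ∀ ω, Φ (fun i => D.power i.1 i.2 ω) = fun i => D.txPower i.1 i.2 ω := by
  refine ⟨fun v i => if h : i.1.1 = D.seller then D.sellerPower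
    else v (⟨i.1.1, Finset.mem_erase.2 ⟨h, i.1.2⟩⟩, i.2), ?_, fun ω => ?_⟩
  · refine measurable_pi_lambda _ fun i => ?_
    by_cases h : i.1.1 = D.seller
    · simp [h]
    · simp only [h, dite_false]
      fun_prop
  · ext i
    by_cases h : i.1.1 = D.seller
    · simp [h, txPower]
    · simp [h, txPower]

variable {D} [MeasurableSpace Ω] {P : Measure Ω} {powerLaw : Measure ℝ}

lemma IsModel.measurable_txPower (hD : D.IsModel powerLaw P) {k : O} (hk : k ∈ D.group) (n : ℕ) :
    Measurable (D.txPower k n) := by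
  unfold txPower
  by_cases h : k = D.seller
  · simp [h]
  · simpa [h] using hD.power_measurable k (Finset.mem_erase.2 ⟨h, hk⟩) n

lemma IsModel.map_txPower [IsProbabilityMeasure P] (hD : D.IsModel powerLaw P) {k : O} (hk : k ∈ D.group) (n : ℕ) :
    P.map (D.txPower k n) = D.txLaw powerLaw k := by
  unfold txPower txLaw
  by_cases h : k = D.seller
  · simp only [h, if_true]
    rw [Measure.map_const]
    simp
  · simpa [h] using (hD.power_law k (Finset.mem_erase.2 ⟨h, hk⟩) n).map_eq

lemma IsModel.iIndepFun_txPower [IsProbabilityMeasure P] (hD : D.IsModel powerLaw P) :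
    iIndepFun (fun i : D.group × ℕ => D.txPower i.1 i.2) P := by
  refine iIndepFun_of_const_off_range
    (e := fun j : {k // k ∈ D.group.erase D.seller} × ℕ =>
      ((⟨j.1.1, Finset.mem_of_mem_erase j.1.2⟩ : D.group), j.2)) ?_ ?_ ?_
  · rintro ⟨⟨i, hi⟩, n⟩ ⟨⟨j, hj⟩, m⟩ h
    simp only [Prod.mk.injEq, Subtype.mk.injEq] at h ⊢
    exact h
  · convert hD.power_indep using 2 with j
    ext ω
    simp [txPower, Finset.ne_of_mem_erase j.1.2]
  · rintro ⟨⟨k, hk⟩, n⟩ hi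
    refine ⟨D.sellerPower, ?_⟩
    have : k = D.seller := by
      by_contra hne
      exact hi ⟨(⟨k, Finset.mem_erase.2 ⟨hne, hk⟩⟩, n), rfl⟩
    ext ω
    simp [txPower, this]

lemma IsModel.isMarkedPoisson [IsProbabilityMeasure P] (hD : D.IsModel powerLaw P) :
    IsMarkedPoisson (fun k : D.group => D.bs k) (fun k : D.group => D.mark k)
      (fun k => D.intensity k) (fun k => (expMeasure 1).prod (D.txLaw powerLaw k)) P := by
  obtain ⟨Φ, hΦm, hΦ⟩ := exists_measurable_txPower D
  have hgp : IndepFun (fun ω (i : D.group × ℕ) => D.gain i.1 i.2 ω)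
      (fun ω (i : D.group × ℕ) => D.txPower i.1 i.2 ω) P := by
    rw [← funext hΦ]
    exact hD.gain_power_indep.comp measurable_id hΦm
  exact {
    poisson := fun k => hD.bs_poisson k k.2
    indep := hD.bs_indep
    mark_measurable := fun k n =>
      (hD.gain_measurable k k.2 n).prodMk (hD.measurable_txPower k.2 n)
    mark_law := fun k n => by
      have := hgp.comp (measurable_pi_apply (k, n)) (measurable_pi_apply (k, n))
      rw [← hD.map_txPower k.2 n, ← (hD.gain_law k k.2 n).map_eq]
      exact this.map_prod_eq_prod_map_map (hD.gain_measurable k k.2 n).aemeasurable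
        (hD.measurable_txPower k.2 n).aemeasurable
    mark_indep := iIndepFun_prodMk_of_indepFun
      (u := fun i : D.group × ℕ => D.gain i.1 i.2) (v := fun i : D.group × ℕ => D.txPower i.1 i.2)
      (fun i => hD.gain_measurable i.1 i.1.2 i.2) (fun i => hD.measurable_txPower i.1.2 i.2)
      hD.gain_indep hD.iIndepFun_txPower hgp
    indep_mark := by
      have := hD.bs_marks_indep.comp (φ := id) (ψ := fun (q : (D.group × ℕ → ℝ) ×
        ({k // k ∈ D.group.erase D.seller} × ℕ → ℝ)) i => (q.1 i, Φ q.2 i)) measurable_id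
        (by fun_prop)
      have hmark : (fun ω (i : D.group × ℕ) => D.mark i.1 i.2 ω)
          = fun ω i => (D.gain i.1 i.2 ω, Φ (fun i => D.power i.1 i.2 ω) i) := by
        funext ω i
        rw [hΦ]
        rfl
      rw [hmark]
      exact this }

end Downlink

/-- An infinite weight on a set of area zero leaves the Laplace functional equal to `1`, so almost
surely no point carries it. -/
lemma IsPoissonProcess.ae_ne {Ω : Type*} [MeasurableSpace Ω] {X : ℕ → Ω → Plane} {r : ℝ≥0}
    {P : Measure Ω} [IsProbabilityMeasure P] (h : IsPoissonProcess X r P) (x : Plane) :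
    ∀ᵐ ω ∂P, ∀ n, X n ω ≠ x := by
  have hB : MeasurableSet ({x} : Set Plane) := measurableSet_singleton x
  have h1 := h.lintegral_nexp_count hB (by simp) ∞
  have hv : volume ({x} : Set Plane) = 0 := by simp
  simp_rw [← tsum_indicator_eq_count, hv, zero_mul, mul_zero, nexp_zero] at h1
  have hm : Measurable fun ω => nexp (∑' n, ({x} : Set Plane).indicator (fun _ => ∞) (X n ω)) :=
    measurable_nexp.comp (Measurable.tsum fun n =>
      (measurable_const.indicator hB).comp (h.measurable n))
  have h2 : ∫⁻ ω, 1 - nexp (∑' n, ({x} : Set Plane).indicator (fun _ => ∞) (X n ω)) ∂P = 0 := by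
    rw [lintegral_sub hm (by rw [h1]; exact ENNReal.one_ne_top)
      (.of_forall fun ω => nexp_le_one _), h1]
    simp
  filter_upwards [(lintegral_eq_zero_iff (f := fun ω => 1 - nexp (∑' n, ({x} : Set Plane).indicator
    (fun _ => ∞) (X n ω))) (measurable_const.sub hm)).1 h2] with ω hω n hn
  have h3 : ∑' n, ({x} : Set Plane).indicator (fun _ => (∞ : ℝ≥0∞)) (X n ω) = ∞ :=
    ENNReal.tsum_eq_top_of_eq_top ⟨n, by rw [indicator_of_mem (by simpa using hn)]⟩
  rw [h3] at hω
  simp at hω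

lemma measurable_apply_of_countable {Ω ι β : Type*} [MeasurableSpace Ω] [MeasurableSpace β]
    [Countable ι] [MeasurableSpace ι] [MeasurableSingletonClass ι] {N : Ω → ι} {F : ι → Ω → β}
    (hN : Measurable N) (hF : ∀ i, Measurable (F i)) : Measurable fun ω => F (N ω) ω :=
  (measurable_from_prod_countable_right (f := fun p : ι × Ω => F p.1 p.2) hF).comp
    (hN.prodMk measurable_id)

namespace Downlink

/-! ### Measurability -/

section Measurability

variable {O Ω : Type*} (D : Downlink O Ω)

/-- The path loss variable `x² / P ^ (2/α)` of the `n`-th base station of buyer `k`. -/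
def pathLoss (k : O) (n : ℕ) (ω : Ω) : ℝ := ‖D.bs k n ω‖ ^ 2 / D.power k n ω ^ (2 / D.α)

/-- Interference at the user of `b` if it is served by the `n`-th base station of `b`. -/
def interferenceFrom [DecidableEq O] (b : O) (n : ℕ) (ω : Ω) : ℝ≥0∞ :=
  (∑' m : ℕ, if m = n then 0 else D.received b m ω)
    + (∑' m : ℕ, ENNReal.ofReal
        (D.sellerPower * D.gain D.seller m ω * ‖D.bs D.seller m ω‖ ^ (-D.α)))
    + ∑ k ∈ D.group \ {D.seller, b}, ∑' m : ℕ, D.received k m ω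

variable {D} {mΩ : MeasurableSpace Ω} {b : O}

/-- The σ-algebra on `Ω` is an arbitrary implicit argument: the result is also needed for the
σ-algebra generated by all data except one gain. -/
lemma measurableSet_serving_eq (hbs : ∀ n, Measurable (D.bs b n))
    (hp : ∀ n, Measurable (D.power b n)) (n : ℕ) : MeasurableSet {ω | D.serving b ω = n} := by
  have hr : ∀ m, Measurable (D.meanReceived b m) := fun m => by
    have := hbs m
    have := hp m
    unfold meanReceived
    fun_prop
  have hS : ∀ j, MeasurableSet {ω | ∀ m, D.meanReceived b m ω ≤ D.meanReceived b j ω} := fun j => by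
    rw [ofPred_forall]
    exact MeasurableSet.iInter fun m => measurableSet_le (hr m) (hr j)
  -- The second set covers outcomes without a maximiser, where `sInf ∅ = 0`.
  have : {ω | D.serving b ω = n}
      = ({ω | ∀ m, D.meanReceived b m ω ≤ D.meanReceived b n ω}
          ∩ ⋂ j ∈ Iio n, {ω | ∀ m, D.meanReceived b m ω ≤ D.meanReceived b j ω}ᶜ)
        ∪ ({_ω | n = 0} ∩ ⋂ j, {ω | ∀ m, D.meanReceived b m ω ≤ D.meanReceived b j ω}ᶜ) := by
    ext ω
    simp only [serving, mem_ofPred_eq, mem_union, mem_inter_iff, mem_iInter, mem_compl_iff, mem_Iio]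
    constructor
    · intro h
      by_cases hne : {j | ∀ m, D.meanReceived b m ω ≤ D.meanReceived b j ω}.Nonempty
      · left
        have := Nat.sInf_mem hne
        rw [h] at this
        refine ⟨this, fun j hj hmem => ?_⟩
        have := Nat.sInf_le (s := {j | ∀ m, D.meanReceived b m ω ≤ D.meanReceived b j ω}) hmem
        omega
      · right
        rw [not_nonempty_iff_eq_empty.1 hne, Nat.sInf_empty] at h
        exact ⟨h.symm, fun j hj => hne ⟨j, hj⟩⟩
    · rintro (⟨h1, h2⟩ | ⟨rfl, h2⟩)
      · refine le_antisymm (Nat.sInf_le h1) (not_lt.1 fun hlt => h2 _ hlt ?_)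
        exact Nat.sInf_mem (s := {j | ∀ m, D.meanReceived b m ω ≤ D.meanReceived b j ω}) ⟨n, h1⟩
      · have : {j | ∀ m, D.meanReceived b m ω ≤ D.meanReceived b j ω} = ∅ :=
          eq_empty_of_forall_notMem h2
        rw [this, Nat.sInf_empty]
  rw [this]
  exact ((hS n).inter (MeasurableSet.biInter (to_countable _) fun j _ => (hS j).compl)).union
    ((MeasurableSet.const _).inter (MeasurableSet.iInter fun j => (hS j).compl))

lemma measurable_pathLoss {n : ℕ} (hbs : Measurable (D.bs b n)) (hp : Measurable (D.power b n)) :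
    Measurable (D.pathLoss b n) := by
  unfold pathLoss
  fun_prop

/-- The hypothesis on the gains spares the `n`-th station of `b`: its gain does not enter the
interference when that station serves. -/
lemma measurable_interferenceFrom [DecidableEq O] {n : ℕ} (hseller : D.seller ∈ D.group)
    (hbuyer : b ∈ D.group) (hne : b ≠ D.seller)
    (hbs : ∀ k ∈ D.group, ∀ m, Measurable (D.bs k m))
    (hp : ∀ k ∈ D.group.erase D.seller, ∀ m, Measurable (D.power k m))
    (hg : ∀ k ∈ D.group, ∀ m, (k = b → m ≠ n) → Measurable (D.gain k m)) :
    Measurable (D.interferenceFrom b n) := by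
  have hrec : ∀ k ∈ D.group.erase D.seller, ∀ m, (k = b → m ≠ n) → Measurable (D.received k m) := by
    intro k hk m hkm
    have := hbs k (Finset.mem_of_mem_erase hk) m
    have := hp k hk m
    have := hg k (Finset.mem_of_mem_erase hk) m hkm
    unfold received
    fun_prop
  unfold interferenceFrom
  refine (Measurable.add (Measurable.tsum fun m => ?_) (Measurable.tsum fun m => ?_)).add
    (Finset.measurable_fun_sum _ fun k hk => Measurable.tsum fun m => ?_)
  · by_cases hm : m = n
    · simp [hm]
    · simpa [hm] using hrec b (Finset.mem_erase.2 ⟨hne, hbuyer⟩) m fun _ => hm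
  · have := hbs _ hseller m
    have := hg _ hseller m fun h => absurd h.symm hne
    fun_prop
  · simp only [Finset.mem_sdiff, Finset.mem_insert, Finset.mem_singleton, not_or] at hk
    exact hrec k (Finset.mem_erase.2 ⟨hk.2.1, hk.1⟩) m fun h => absurd h hk.2.2

end Measurability

/-! ### Standing hypotheses and the fading of the serving station. -/

variable {O Ω : Type*} [DecidableEq O] [MeasurableSpace Ω]

/-- The model together with the regularity of the law of the transmit power of a buyer. -/
structure IsRegular (D : Downlink O Ω) (b : O) (powerLaw : Measure ℝ) (M : ℝ) (P : Measure Ω) :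
    Prop where
  model : D.IsModel powerLaw P
  seller_mem : D.seller ∈ D.group
  buyer_mem : b ∈ D.group
  buyer_ne : b ≠ D.seller
  intensity_pos : 0 < D.intensity b
  two_lt : 2 < D.α
  sellerPower_pos : 0 < D.sellerPower
  isProbabilityMeasure : IsProbabilityMeasure powerLaw
  ae_pos : ∀ᵐ p ∂powerLaw, 0 < p
  moment : ∫⁻ p, ENNReal.ofReal (p ^ (2 / D.α)) ∂powerLaw = ENNReal.ofReal M
  moment_pos : 0 < M

namespace IsRegular

variable {D : Downlink O Ω} {b : O} {P : Measure Ω} {powerLaw : Measure ℝ} {M : ℝ}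

lemma measurable_bs (S : D.IsRegular b powerLaw M P) {k : O} (hk : k ∈ D.group) (n : ℕ) :
    Measurable (D.bs k n) := (S.model.bs_poisson k hk).measurable n

lemma buyer_mem_erase (S : D.IsRegular b powerLaw M P) : b ∈ D.group.erase D.seller :=
  Finset.mem_erase.2 ⟨S.buyer_ne, S.buyer_mem⟩

lemma measurable_servingZ_interference (S : D.IsRegular b powerLaw M P) :
    Measurable (fun ω => (D.servingZ b ω, D.interference b ω)) := by
  have hN : ∀ n, MeasurableSet {ω | D.serving b ω = n} :=
    measurableSet_serving_eq (S.measurable_bs S.buyer_mem)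
      (S.model.power_measurable b S.buyer_mem_erase)
  have hNm : Measurable (D.serving b) := measurable_to_countable' fun n => hN n
  exact (measurable_apply_of_countable hNm fun n => measurable_pathLoss
    (S.measurable_bs S.buyer_mem n) (S.model.power_measurable b S.buyer_mem_erase n)).prodMk
    (measurable_apply_of_countable (F := D.interferenceFrom b) hNm fun n => measurable_interferenceFrom S.seller_mem
      S.buyer_mem S.buyer_ne (fun k hk => S.measurable_bs hk) S.model.power_measurable
      fun k hk m _ => S.model.gain_measurable k hk m)

lemma measurable_servingZ (S : D.IsRegular b powerLaw M P) : Measurable (D.servingZ b) :=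
  measurable_fst.comp S.measurable_servingZ_interference

lemma measurable_interference (S : D.IsRegular b powerLaw M P) : Measurable (D.interference b) :=
  measurable_snd.comp S.measurable_servingZ_interference

/-- The gain of the serving base station has the exponential law and is independent of the
serving distance variable and of the interference. -/
lemma lintegral_serving_gain [IsProbabilityMeasure P] (S : D.IsRegular b powerLaw M P)
    {g : ℝ × (ℝ × ℝ≥0∞) → ℝ≥0∞} (hg : Measurable g) :
    ∫⁻ ω, g (D.gain b (D.serving b ω) ω, (D.servingZ b ω, D.interference b ω)) ∂P
      = ∫⁻ ω, ∫⁻ x, g (x, (D.servingZ b ω, D.interference b ω)) ∂(expMeasure 1) ∂P := by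
  have hgm : ∀ i : D.group × ℕ, Measurable (D.gain i.1 i.2) := fun i =>
    S.model.gain_measurable i.1 i.1.2 i.2
  have hpm : Measurable fun ω (i : {k // k ∈ D.group.erase D.seller} × ℕ) => D.power i.1 i.2 ω :=
    measurable_pi_lambda _ fun i => S.model.power_measurable i.1 i.1.2 i.2
  have hbm : Measurable fun ω (i : D.group × ℕ) => D.bs i.1 i.2 ω :=
    measurable_pi_lambda _ fun i => S.measurable_bs i.1.2 i.2
  set idx : ℕ → D.group × ℕ := fun n => (⟨b, S.buyer_mem⟩, n) with hidx
  -- All gains, with that of the `n`-th station of `b` overwritten by `0`. Together with powers and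
  -- positions it forms data `V n` that determine the association and the interference but are
  -- independent of the erased gain.
  set G : ℕ → Ω → (D.group × ℕ → ℝ) := fun n ω i =>
    if i = idx n then 0 else D.gain i.1 i.2 ω with hG
  have hGm : ∀ n, Measurable (G n) := fun n => measurable_pi_lambda _ fun i => by
    by_cases hi : i = idx n
    · simp [hG, hi]
    · simpa [hG, hi] using hgm i
  set V : ℕ → Ω → ((D.group × ℕ → ℝ) × ({k // k ∈ D.group.erase D.seller} × ℕ → ℝ))
      × (D.group × ℕ → Plane) := fun n ω =>
    ((G n ω, fun i => D.power i.1 i.2 ω), fun i => D.bs i.1 i.2 ω) with hV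
  have hVm : ∀ n, Measurable (V n) := fun n => ((hGm n).prodMk hpm).prodMk hbm
  have hVc : ∀ n, Measurable[MeasurableSpace.comap (V n) inferInstance] (V n) := fun n =>
    comap_measurable _
  have hVbs : ∀ n, ∀ k ∈ D.group, ∀ m,
      Measurable[MeasurableSpace.comap (V n) inferInstance] (D.bs k m) := fun n k hk m =>
    ((measurable_pi_apply ((⟨k, hk⟩, m) : D.group × ℕ)).comp measurable_snd).comp (hVc n)
  have hVp : ∀ n, ∀ k ∈ D.group.erase D.seller, ∀ m,
      Measurable[MeasurableSpace.comap (V n) inferInstance] (D.power k m) := fun n k hk m =>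
    ((measurable_pi_apply ((⟨k, hk⟩, m) : {k // k ∈ D.group.erase D.seller} × ℕ)).comp (measurable_snd.comp measurable_fst)).comp (hVc n)
  have hVg : ∀ n, ∀ k ∈ D.group, ∀ m, (k = b → m ≠ n) →
      Measurable[MeasurableSpace.comap (V n) inferInstance] (D.gain k m) := fun n k hk m hkm => by
    have := ((measurable_pi_apply ((⟨k, hk⟩ : D.group), m)).comp
      (measurable_fst.comp measurable_fst)).comp (hVc n)
    convert this using 1
    ext ω
    have hi : ¬ (((⟨k, hk⟩ : D.group), m) = idx n) := by
      simpa [hidx, Prod.ext_iff] using hkm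
    simp [hV, hG, hi]
  refine lintegral_selected (N := D.serving b) (h := D.gain b)
    (W := fun ω => (D.servingZ b ω, D.interference b ω)) (V := V)
    (Wn := fun n ω => (D.pathLoss b n ω, D.interferenceFrom b n ω))
    (fun n => measurableSet_serving_eq (hVbs n b S.buyer_mem) (hVp n b S.buyer_mem_erase) n)
    (fun n => Measurable.prodMk (measurable_pathLoss (hVbs n b S.buyer_mem n)
      (hVp n b S.buyer_mem_erase n)) (measurable_interferenceFrom S.seller_mem S.buyer_mem
        S.buyer_ne (hVbs n) (hVp n) (hVg n)))
    (fun ω => rfl) (fun n => S.model.gain_measurable b S.buyer_mem n) hVm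
    (fun n => (S.model.gain_law b S.buyer_mem n).map_eq) (fun n => ?_) hg
  have hgn : Measurable (D.gain b n) := S.model.gain_measurable b S.buyer_mem n
  have h1 : IndepFun (D.gain b n) (G n) P := by
    have := (iIndepFun.indepFun_ne hgm S.model.gain_indep (idx n)).comp
      (φ := id) (ψ := fun (v : {i : D.group × ℕ // i ≠ idx n} → ℝ)
        (i : D.group × ℕ) => if hi : i = idx n then (0 : ℝ) else v ⟨i, hi⟩)
      measurable_id (measurable_pi_lambda _ fun i => by
        by_cases hi : i = idx n
        · simp [hi]
        · simp only [hi, dite_false]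
          exact measurable_pi_apply _)
    exact this
  have h2 : IndepFun (fun ω => (D.gain b n ω, G n ω))
      (fun ω (i : {k // k ∈ D.group.erase D.seller} × ℕ) => D.power i.1 i.2 ω) P :=
    S.model.gain_power_indep.comp (φ := fun (v : D.group × ℕ → ℝ) =>
      (v (idx n), fun i => if i = idx n then (0 : ℝ) else v i))
      (ψ := id) (by
        refine (measurable_pi_apply (idx n)).prodMk (measurable_pi_lambda _ fun i => ?_)
        by_cases hi : i = idx n
        · simp [hi]
        · simp only [hi, if_false]
          exact measurable_pi_apply _) measurable_id
  have h3 := IndepFun.prodMk_right_of_prodMk_left hgn (hGm n) hpm h1 h2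
  refine IndepFun.prodMk_right_of_prodMk_left hgn ((hGm n).prodMk hpm) hbm h3 ?_
  exact S.model.bs_marks_indep.symm.comp (φ := fun (q : (D.group × ℕ → ℝ) ×
      ({k // k ∈ D.group.erase D.seller} × ℕ → ℝ)) => (q.1 (idx n),
        ((fun i => if i = idx n then (0 : ℝ) else q.1 i), q.2))) (ψ := id) (by
        refine Measurable.prodMk (by fun_prop) (Measurable.prodMk
          (measurable_pi_lambda _ fun i => ?_) measurable_snd)
        by_cases hi : i = idx n
        · simp [hi]
        · simp only [hi, if_false]
          fun_prop) measurable_id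

end IsRegular

end Downlink

/-! ### Laplace transform of the total received power. -/

namespace Downlink

variable {O Ω : Type*} [DecidableEq O]

/-- Power received at the origin from the `n`-th base station of operator `k`. -/
def rxPower (D : Downlink O Ω) (k : O) (n : ℕ) (ω : Ω) : ℝ≥0∞ :=
  ENNReal.ofReal (D.txPower k n ω * D.gain k n ω * ‖D.bs k n ω‖ ^ (-D.α))

/-- Power received at the origin from all base stations. -/
def totalPower (D : Downlink O Ω) (ω : Ω) : ℝ≥0∞ := ∑ k : D.group, ∑' n, D.rxPower k n ω

/-- Laplace exponent of the received power, on the event that the base stations of `b` have path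
loss variable larger than `t`. -/
def laplaceExponent (D : Downlink O Ω) (b : O) (M κ t : ℝ) : ℝ :=
  ∑ k : D.group, D.intensity k * (Real.pi * D.txMoment M k
    * gapIntegral (D.α / 2) κ (if (k : O) = b then t else 0))

lemma pathLoss_pos {O Ω : Type*} {D : Downlink O Ω} {b : O} {n : ℕ} {ω : Ω} (hp : 0 < D.power b n ω)
    (hx : D.bs b n ω ≠ 0) : 0 < D.pathLoss b n ω := by
  have hd : 0 < ‖D.bs b n ω‖ := norm_pos_iff.2 hx
  unfold pathLoss
  positivity

namespace IsRegular

variable [MeasurableSpace Ω] {D : Downlink O Ω} {b : O} {P : Measure Ω} {powerLaw : Measure ℝ}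
  {M : ℝ}

lemma txLaw_isProbabilityMeasure (S : D.IsRegular b powerLaw M P) (k : O) :
    IsProbabilityMeasure (D.txLaw powerLaw k) := by
  have := S.isProbabilityMeasure
  unfold txLaw
  split_ifs <;> infer_instance

lemma ae_txLaw_pos (S : D.IsRegular b powerLaw M P) (k : O) :
    ∀ᵐ p ∂(D.txLaw powerLaw k), 0 < p := by
  unfold txLaw
  split_ifs
  · rw [ae_dirac_iff measurableSet_Ioi]
    exact S.sellerPower_pos
  · exact S.ae_pos

lemma txMoment_pos (S : D.IsRegular b powerLaw M P) (k : O) : 0 < D.txMoment M k := by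
  unfold txMoment
  split_ifs
  · exact Real.rpow_pos_of_pos S.sellerPower_pos _
  · exact S.moment_pos

lemma lintegral_txLaw_rpow (S : D.IsRegular b powerLaw M P) (k : O) :
    ∫⁻ p, ENNReal.ofReal (p ^ (2 / D.α)) ∂(D.txLaw powerLaw k)
      = ENNReal.ofReal (D.txMoment M k) := by
  unfold txLaw txMoment
  split_ifs
  · rw [lintegral_dirac' _ (by fun_prop)]
  · exact S.moment

lemma lintegral_bsCost_txLaw (S : D.IsRegular b powerLaw M P) (k : O) {κ : ℝ} (hκ : 0 ≤ κ) (t : ℝ) :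
    ∫⁻ x, ∫⁻ e, 1 - nexp (bsCost D.α κ t (x, e)) ∂((expMeasure 1).prod (D.txLaw powerLaw k))
      = ENNReal.ofReal (Real.pi * D.txMoment M k * gapIntegral (D.α / 2) κ (max t 0)) := by
  have := S.txLaw_isProbabilityMeasure k
  exact lintegral_bsCost S.two_lt hκ t _ (S.ae_txLaw_pos k) (S.lintegral_txLaw_rpow k)

lemma txPower_buyer (S : D.IsRegular b powerLaw M P) (n : ℕ) (ω : Ω) :
    D.txPower b n ω = D.power b n ω := if_neg S.buyer_ne

/-- Restoring the serving signal removes the random index from the sums, so the Laplace functional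
applies to the total. -/
lemma totalPower_eq (S : D.IsRegular b powerLaw M P) (ω : Ω) :
    D.totalPower ω = D.received b (D.serving b ω) ω + D.interference b ω := by
  have hb : ∀ k, k ≠ D.seller → ∀ n, D.rxPower k n ω = D.received k n ω := fun k hk n => by
    simp [rxPower, received, txPower, hk]
  have hsub : ({D.seller, b} : Finset O) ⊆ D.group := by
    intro k hk
    rcases Finset.mem_insert.1 hk with rfl | hk
    · exact S.seller_mem
    · rw [Finset.mem_singleton.1 hk]
      exact S.buyer_mem
  have hothers : ∑ k ∈ D.group \ {D.seller, b}, ∑' n, D.rxPower k n ω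
      = ∑ k ∈ D.group \ {D.seller, b}, ∑' n, D.received k n ω := by
    refine Finset.sum_congr rfl fun k hk => tsum_congr fun n => hb k ?_ n
    simp only [Finset.mem_sdiff, Finset.mem_insert, not_or] at hk
    exact hk.2.1
  have hbuyer : ∑' n, D.rxPower b n ω = D.received b (D.serving b ω) ω
      + ∑' n, if n = D.serving b ω then 0 else D.received b n ω := by
    simp_rw [hb b S.buyer_ne]
    convert ENNReal.tsum_eq_add_tsum_ite (f := fun n => D.received b n ω) (D.serving b ω)
  have hsell : ∑' n, D.rxPower D.seller n ω = ∑' n, ENNReal.ofReal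
      (D.sellerPower * D.gain D.seller n ω * ‖D.bs D.seller n ω‖ ^ (-D.α)) := by
    simp [rxPower, txPower]
  rw [totalPower, Finset.sum_coe_sort D.group (fun k => ∑' n, D.rxPower k n ω),
    ← Finset.sum_sdiff hsub, hothers, Finset.sum_pair S.buyer_ne.symm, hbuyer, hsell, interference]
  ring

lemma ae_txPower_pos (S : D.IsRegular b powerLaw M P) :
    ∀ᵐ ω ∂P, ∀ n, 0 < D.power b n ω := by
  refine ae_all_iff.2 fun n => ?_
  have h : ∀ᵐ p ∂(P.map (D.power b n)), 0 < p := by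
    rw [(S.model.power_law b S.buyer_mem_erase n).map_eq]
    exact S.ae_pos
  exact ae_of_ae_map (S.model.power_measurable b S.buyer_mem_erase n).aemeasurable h

lemma ae_bs_ne_zero [IsProbabilityMeasure P] (S : D.IsRegular b powerLaw M P) : ∀ᵐ ω ∂P, ∀ n, D.bs b n ω ≠ 0 :=
  (S.model.bs_poisson b S.buyer_mem).ae_ne 0

lemma ae_totalPower_ne_top [IsProbabilityMeasure P] (S : D.IsRegular b powerLaw M P) : ∀ᵐ ω ∂P, D.totalPower ω ≠ ∞ := by
  have h : ∀ k : D.group, ∀ᵐ ω ∂P, ∑' n, D.rxPower k n ω ≠ ∞ := fun k => by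
    refine S.model.isMarkedPoisson.ae_tsum_ne_top k
      (f := fun q => ENNReal.ofReal (q.2.2 * q.2.1 * ‖q.1‖ ^ (-D.α))) (by fun_prop)
      (fun q => ENNReal.ofReal_ne_top) ?_
    -- The received power is at most `bsCost` with `κ = 1` and `t = 0`, whose exponent is already
    -- known to be finite.
    refine ne_top_of_le_ne_top ?_ (lintegral_mono fun x => lintegral_mono fun e =>
      tsub_le_tsub_left (nexp_antitone (?_ : _ ≤ bsCost D.α 1 0 (x, e))) 1)
    · rw [S.lintegral_bsCost_txLaw k zero_le_one]
      exact ENNReal.ofReal_ne_top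
    · rw [bsCost, one_mul]
      exact le_add_self
  filter_upwards [ae_all_iff.2 h] with ω hω
  exact ENNReal.sum_ne_top.2 fun k _ => hω k

lemma ae_interference_ne_top [IsProbabilityMeasure P] (S : D.IsRegular b powerLaw M P) :
    ∀ᵐ ω ∂P, D.interference b ω ≠ ∞ := by
  filter_upwards [S.ae_totalPower_ne_top] with ω hω
  rw [S.totalPower_eq] at hω
  exact (ENNReal.add_ne_top.1 hω).2

/-- With cost `1` on each station of path loss at most `t`, the sum is almost surely finite, so
finitely many stations contribute. -/
lemma ae_finite_pathLoss_le [IsProbabilityMeasure P] (S : D.IsRegular b powerLaw M P) :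
    ∀ᵐ ω ∂P, ∀ t : ℕ, {n | D.pathLoss b n ω ≤ t}.Finite := by
  refine ae_all_iff.2 fun t => ?_
  have hms : MeasurableSet {q : Plane × (ℝ × ℝ) | ‖q.1‖ ^ 2 / q.2.2 ^ (2 / D.α) ≤ t} :=
    measurableSet_le (by fun_prop) measurable_const
  have h := S.model.isMarkedPoisson.ae_tsum_ne_top ⟨b, S.buyer_mem⟩
    (f := fun q => if ‖q.1‖ ^ 2 / q.2.2 ^ (2 / D.α) ≤ t then 1 else 0)
    (Measurable.ite hms measurable_const measurable_const) (fun q => by split_ifs <;> simp) (by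
      refine ne_top_of_le_ne_top ?_ (lintegral_mono fun x => lintegral_mono fun e =>
        tsub_le_tsub_left (nexp_antitone (?_ : _ ≤ bsCost D.α 0 t (x, e))) 1)
      · rw [S.lintegral_bsCost_txLaw b le_rfl]
        exact ENNReal.ofReal_ne_top
      · rw [bsCost]
        refine le_trans ?_ le_self_add
        split_ifs <;> simp)
  filter_upwards [h] with ω hω
  have := ENNReal.finite_const_le_of_tsum_ne_top hω one_ne_zero
  refine this.subset fun n hn => ?_
  simp only [mem_ofPred_eq, mark, S.txPower_buyer, pathLoss] at hn ⊢
  rw [if_pos hn]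

/-- Maximal average received power therefore means minimal path loss. -/
lemma meanReceived_eq (S : D.IsRegular b powerLaw M P) {n : ℕ} {ω : Ω} (hp : 0 < D.power b n ω)
    (hx : D.bs b n ω ≠ 0) : D.meanReceived b n ω = D.pathLoss b n ω ^ (-(D.α / 2)) := by
  have hα : 0 < D.α := by linarith [S.two_lt]
  have hd : 0 < ‖D.bs b n ω‖ := norm_pos_iff.2 hx
  rw [pathLoss, Real.rpow_neg (by positivity), pathLoss_rpow hα hd hp, inv_div, meanReceived,
    Real.rpow_neg hd.le, div_eq_mul_inv]

/-- Local finiteness makes the minimum attained: a minimiser over the finite set of stations with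
path loss at most some `t`, nonempty because it contains the index `0`, is global. Thus `serving` is
almost surely not the default value of `sInf ∅`. -/
lemma ae_servingZ_le [IsProbabilityMeasure P] (S : D.IsRegular b powerLaw M P) :
    ∀ᵐ ω ∂P, ∀ n, D.servingZ b ω ≤ D.pathLoss b n ω := by
  filter_upwards [S.ae_txPower_pos, S.ae_bs_ne_zero, S.ae_finite_pathLoss_le] with ω hp hx hfin
  have hα : 0 < D.α := by linarith [S.two_lt]
  have hpos : ∀ n, 0 < D.pathLoss b n ω := fun n => pathLoss_pos (hp n) (hx n)
  have hiff : ∀ m n, D.meanReceived b m ω ≤ D.meanReceived b n ω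
      ↔ D.pathLoss b n ω ≤ D.pathLoss b m ω := fun m n => by
    rw [S.meanReceived_eq (hp m) (hx m), S.meanReceived_eq (hp n) (hx n),
      Real.rpow_le_rpow_iff_of_neg (hpos m) (hpos n) (by linarith)]
  have hne : {n | ∀ m, D.meanReceived b m ω ≤ D.meanReceived b n ω}.Nonempty := by
    obtain ⟨t, ht⟩ := exists_nat_ge (D.pathLoss b 0 ω)
    obtain ⟨n, hn, hmin⟩ := exists_min_image _ (fun n => D.pathLoss b n ω) (hfin t) ⟨0, ht⟩
    refine ⟨n, fun m => (hiff m n).2 ?_⟩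
    rcases le_or_gt (D.pathLoss b m ω) t with hm | hm
    · exact hmin m hm
    · exact (show D.pathLoss b n ω ≤ t from hn).trans hm.le
  intro n
  exact (hiff n _).1 (Nat.sInf_mem hne n)

lemma ae_servingZ_pos [IsProbabilityMeasure P] (S : D.IsRegular b powerLaw M P) : ∀ᵐ ω ∂P, 0 < D.servingZ b ω := by
  filter_upwards [S.ae_txPower_pos, S.ae_bs_ne_zero] with ω hp hx
  exact pathLoss_pos (hp _) (hx _)

lemma ae_received_serving [IsProbabilityMeasure P] (S : D.IsRegular b powerLaw M P) :
    ∀ᵐ ω ∂P, D.received b (D.serving b ω) ω = ENNReal.ofReal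
      (D.servingZ b ω ^ (-(D.α / 2)) * D.gain b (D.serving b ω) ω) := by
  filter_upwards [S.ae_txPower_pos, S.ae_bs_ne_zero] with ω hp hx
  have := S.meanReceived_eq (hp (D.serving b ω)) (hx _)
  rw [show D.servingZ b ω = D.pathLoss b (D.serving b ω) ω from rfl, ← this, received, meanReceived]
  congr 1
  ring

/-- Laplace transform of the total received power, on the event that the serving base station has
path loss variable larger than `t`. -/
lemma lintegral_totalPower [IsProbabilityMeasure P] (S : D.IsRegular b powerLaw M P) {κ t : ℝ} (hκ : 0 ≤ κ) (ht : 0 ≤ t) :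
    ∫⁻ ω, {ω | t < D.servingZ b ω}.indicator
      (fun ω => nexp (ENNReal.ofReal κ * D.totalPower ω)) ω ∂P
      = ENNReal.ofReal (Real.exp (-D.laplaceExponent b M κ t)) := by
  -- Only the stations of `b` are excluded below `t`; the other operators may have stations
  -- arbitrarily close.
  set f : D.group → Plane × (ℝ × ℝ) → ℝ≥0∞ := fun k =>
    if (k : O) = b then bsCost D.α κ t
    else fun q => ENNReal.ofReal (κ * (q.2.2 * q.2.1 * ‖q.1‖ ^ (-D.α))) with hf
  have hfm : ∀ k, Measurable (f k) := fun k => by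
    simp only [hf]
    split_ifs <;> fun_prop
  have hterm : ∀ ω, ∀ k : D.group, ∀ n, f k (D.bs k n ω, D.mark k n ω)
      = (if (k : O) = b ∧ D.pathLoss b n ω ≤ t then ∞ else 0)
        + ENNReal.ofReal κ * D.rxPower k n ω := fun ω k n => by
    by_cases hk : (k : O) = b
    · simp only [hf, hk, bsCost, mark, if_true, true_and, rxPower, S.txPower_buyer, pathLoss,
        ENNReal.ofReal_mul hκ]
    · simp only [hf, hk, mark, if_false, false_and, rxPower, zero_add, ENNReal.ofReal_mul hκ]
  have hind : ∀ᵐ ω ∂P, {ω | t < D.servingZ b ω}.indicator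
      (fun ω => nexp (ENNReal.ofReal κ * D.totalPower ω)) ω
      = nexp (∑ k : D.group, ∑' n, f k (D.bs k n ω, D.mark k n ω)) := by
    filter_upwards [S.ae_servingZ_le] with ω hω
    by_cases hZ : t < D.servingZ b ω
    · rw [indicator_of_mem (by exact hZ)]
      have : ∀ n, ¬ D.pathLoss b n ω ≤ t := fun n => not_le.2 (hZ.trans_le (hω n))
      simp_rw [hterm, this, and_false, if_false, zero_add, ENNReal.tsum_mul_left, ← Finset.mul_sum]
      rfl
    · rw [indicator_of_notMem (by exact hZ)]
      symm
      rw [nexp_eq_zero_iff]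
      refine ENNReal.sum_eq_top.2 ⟨⟨b, S.buyer_mem⟩, Finset.mem_univ _, ?_⟩
      -- On `Z ≤ t` the serving station itself has infinite cost, which reproduces the indicator.
      refine ENNReal.tsum_eq_top_of_eq_top ⟨D.serving b ω, ?_⟩
      rw [hterm, if_pos ⟨rfl, not_lt.1 hZ⟩, top_add]
  rw [lintegral_congr_ae hind, S.model.isMarkedPoisson.laplace hfm]
  have hin : ∀ k : D.group, ∫⁻ x, ∫⁻ e, 1 - nexp (f k (x, e))
      ∂((expMeasure 1).prod (D.txLaw powerLaw k))
      = ENNReal.ofReal (Real.pi * D.txMoment M k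
        * gapIntegral (D.α / 2) κ (if (k : O) = b then t else 0)) := fun k => by
    by_cases hk : (k : O) = b
    · simp only [hf, hk, if_true]
      rw [S.lintegral_bsCost_txLaw b hκ t, max_eq_left ht]
    -- Path loss is never at most `-1`, so `t = -1` removes the exclusion while `max t 0 = 0`.
    · have h0 := S.lintegral_bsCost_txLaw k hκ (-1)
      rw [max_eq_right (by norm_num)] at h0
      simp only [hf, hk, if_false]
      rw [← h0]
      have := S.txLaw_isProbabilityMeasure k
      refine lintegral_congr fun x => ?_
      rw [lintegral_prod_symm' _ (by fun_prop), lintegral_prod_symm' _ (by fun_prop)]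
      refine lintegral_congr_ae ?_
      filter_upwards [S.ae_txLaw_pos k] with p hp
      refine lintegral_congr fun h => ?_
      have : ¬ ‖x‖ ^ 2 / p ^ (2 / D.α) ≤ -1 := by
        have : 0 ≤ ‖x‖ ^ 2 / p ^ (2 / D.α) := by positivity
        linarith
      simp only [bsCost, this, if_false, zero_add]
  simp_rw [hin]
  have hg : ∀ k : D.group, 0 ≤ Real.pi * D.txMoment M k
      * gapIntegral (D.α / 2) κ (if (k : O) = b then t else 0) := fun k =>
    mul_nonneg (mul_nonneg Real.pi_nonneg (S.txMoment_pos k).le)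
      (gapIntegral_nonneg hκ (by split_ifs <;> simp [ht]))
  simp_rw [← ENNReal.ofReal_coe_nnreal, ← ENNReal.ofReal_mul (NNReal.coe_nonneg _)]
  rw [← ENNReal.ofReal_sum_of_nonneg fun k _ => mul_nonneg (NNReal.coe_nonneg _) (hg k),
    nexp_ofReal (Finset.sum_nonneg fun k _ => mul_nonneg (NNReal.coe_nonneg _) (hg k)),
    laplaceExponent]

end IsRegular

end Downlink

/-! ### Dependence of the Laplace exponent on its parameters -/

lemma continuous_div_abs_rpow_add {a κ : ℝ} (ha : 0 < a) (hκ : 0 ≤ κ) :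
    Continuous fun w : ℝ => κ / (|w| ^ a + κ) := by
  rcases hκ.eq_or_lt with rfl | hκ
  · simpa using continuous_const
  · refine continuous_const.div ((continuous_abs.rpow_const fun _ => Or.inr ha.le).add
      continuous_const) fun w => ?_
    positivity

/-- The absolute value makes the integrand continuous on the whole line, so the right side is
differentiable everywhere. -/
lemma gapIntegral_eq_sub {a κ t : ℝ} (ha : 1 < a) (hκ : 0 ≤ κ) (ht : 0 ≤ t) :
    gapIntegral a κ t = t + (∫ w in Ioi (0 : ℝ), κ / (w ^ a + κ))
      - ∫ w in (0 : ℝ)..t, κ / (|w| ^ a + κ) := by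
  have hi := integrableOn_div_rpow_add ha hκ
  rw [gapIntegral, ← intervalIntegral.integral_interval_add_Ioi hi
    (hi.mono_set (Ioi_subset_Ioi ht))]
  have : ∫ w in (0 : ℝ)..t, κ / (w ^ a + κ) = ∫ w in (0 : ℝ)..t, κ / (|w| ^ a + κ) := by
    refine intervalIntegral.integral_congr fun w hw => ?_
    rw [uIcc_of_le ht] at hw
    simp only [abs_of_nonneg hw.1]
  rw [this]; ring

/-- The integrand is minus the derivative of `e^{-(c·gap + d)}`, because `gap' (u) = 1 - κ/(u^a +
κ)`; the exponential vanishes at infinity since `gap u ≥ u`. -/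
lemma lintegral_Ioi_exp_gapIntegral {a κ c t : ℝ} (d : ℝ) (ha : 1 < a) (hκ : 0 ≤ κ) (hc : 0 < c)
    (ht : 0 ≤ t) :
    ∫⁻ u in Ioi t, ENNReal.ofReal
      ((1 - κ / (u ^ a + κ)) * (c * Real.exp (-(c * gapIntegral a κ u + d))))
      = ENNReal.ofReal (Real.exp (-(c * gapIntegral a κ t + d))) := by
  set f : ℝ → ℝ := fun w => κ / (|w| ^ a + κ) with hf
  have hfc : Continuous f := continuous_div_abs_rpow_add (by linarith) hκ
  have hf1 : ∀ w, f w ≤ 1 := fun w => by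
    have := Real.rpow_nonneg (abs_nonneg w) a
    exact div_le_one_of_le₀ (by linarith) (by linarith)
  set g : ℝ → ℝ := fun u => u + (∫ w in Ioi (0 : ℝ), κ / (w ^ a + κ)) - ∫ w in (0 : ℝ)..u, f w
    with hg
  have hgeq : ∀ u, 0 ≤ u → gapIntegral a κ u = g u := fun u hu => gapIntegral_eq_sub ha hκ hu
  have hgd : ∀ u, HasDerivAt g (1 - f u) u := fun u =>
    ((hasDerivAt_id u).add_const _).sub (hfc.integral_hasStrictDerivAt 0 u).hasDerivAt
  set E : ℝ → ℝ := fun u => Real.exp (-(c * g u + d)) with hE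
  have hEd : ∀ u, HasDerivAt E (-((1 - f u) * (c * E u))) u := fun u => by
    convert (((hgd u).const_mul c).add_const d).fun_neg.exp using 1
    simp only [hE]
    ring
  have hlim : Filter.Tendsto E Filter.atTop (nhds 0) := by
    refine Real.tendsto_exp_atBot.comp (Filter.tendsto_neg_atTop_atBot.comp ?_)
    refine Filter.tendsto_atTop_add_const_right _ _ (Filter.Tendsto.const_mul_atTop hc ?_)
    refine Filter.tendsto_atTop_mono' _ ?_ Filter.tendsto_id
    filter_upwards [Filter.eventually_ge_atTop 0] with u hu
    rw [← hgeq u hu, gapIntegral]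
    refine le_add_of_nonneg_right (setIntegral_nonneg measurableSet_Ioi fun w hw => ?_)
    have := Real.rpow_nonneg (hu.trans (le_of_lt hw)) a
    positivity
  have hneg : ∀ u ∈ Ioi t, -((1 - f u) * (c * E u)) ≤ 0 := fun u _ =>
    neg_nonpos.2 (mul_nonneg (sub_nonneg.2 (hf1 u)) (mul_nonneg hc.le (Real.exp_nonneg _)))
  have hint := integral_Ioi_of_hasDerivAt_of_nonpos' (a := t) (fun u _ => hEd u) hneg hlim
  have hintb := integrableOn_Ioi_deriv_of_nonpos' (a := t) (fun u _ => hEd u) hneg hlim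
  rw [integral_neg, zero_sub, neg_inj] at hint
  have hintb' : IntegrableOn (fun u => (1 - f u) * (c * E u)) (Ioi t) := by
    have h := hintb.neg
    exact h.congr_fun (fun u _ => by simp) measurableSet_Ioi
  rw [hgeq t ht, ← show E t = Real.exp (-(c * g t + d)) from rfl, ← hint,
    ofReal_integral_eq_lintegral_ofReal hintb'
      ((ae_restrict_mem measurableSet_Ioi).mono fun u hu => neg_nonpos.1 (hneg u hu))]
  refine setLIntegral_congr_fun measurableSet_Ioi fun u hu => ?_
  have hu0 : 0 ≤ u := ht.trans (le_of_lt hu)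
  simp only [hE, hf, hgeq u hu0, abs_of_nonneg hu0]

/-- `κ/(w^a + κ)` increases with `κ`, so for approximation from below the limit integrand dominates.
-/
lemma tendsto_gapIntegral {a κ t : ℝ} {κn : ℕ → ℝ} (ha : 1 < a) (hκ : 0 ≤ κ) (ht : 0 ≤ t)
    (hκn : ∀ n, 0 ≤ κn n) (hle : ∀ n, κn n ≤ κ)
    (hlim : Filter.Tendsto κn Filter.atTop (nhds κ)) :
    Filter.Tendsto (fun n => gapIntegral a (κn n) t) Filter.atTop (nhds (gapIntegral a κ t)) := by
  refine Filter.Tendsto.const_add _ (tendsto_integral_of_dominated_convergence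
    (fun w => κ / (w ^ a + κ))
    (fun n => (by fun_prop : Measurable fun w : ℝ => κn n / (w ^ a + κn n)).aestronglyMeasurable)
    ((integrableOn_div_rpow_add ha hκ).mono_set (Ioi_subset_Ioi ht)) (fun n => ?_) ?_)
  · filter_upwards [ae_restrict_mem measurableSet_Ioi] with w hw
    have hw : 0 < w := ht.trans_lt hw
    have hpw : 0 < w ^ a := Real.rpow_pos_of_pos hw a
    have := hκn n
    rw [Real.norm_of_nonneg (by positivity), div_le_div_iff₀ (by positivity) (by positivity)]
    nlinarith [hle n]
  · filter_upwards [ae_restrict_mem measurableSet_Ioi] with w hw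
    have hw : 0 < w := ht.trans_lt hw
    have hpw : 0 < w ^ a := Real.rpow_pos_of_pos hw a
    exact hlim.div (hlim.const_add _) (by positivity)

lemma measurable_gapIntegral (a : ℝ) : Measurable fun q : ℝ × ℝ => gapIntegral a q.1 q.2 := by
  have hF : Measurable fun p : (ℝ × ℝ) × ℝ =>
      {p : (ℝ × ℝ) × ℝ | p.1.2 < p.2}.indicator (fun p => p.1.1 / (p.2 ^ a + p.1.1)) p :=
    Measurable.indicator (by fun_prop) (measurableSet_lt (by fun_prop) (by fun_prop))
  have h : (fun q : ℝ × ℝ => gapIntegral a q.1 q.2) = fun q => q.2 + ∫ w,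
      {p : (ℝ × ℝ) × ℝ | p.1.2 < p.2}.indicator (fun p => p.1.1 / (p.2 ^ a + p.1.1)) (q, w) := by
    funext q
    rw [gapIntegral, ← integral_indicator measurableSet_Ioi]
    rfl
  rw [h]
  exact measurable_snd.add hF.stronglyMeasurable.integral_prod_right'.measurable

/-! ### The Laplace exponent of all operators and its closed form. -/

namespace Downlink

variable {O Ω : Type*} [DecidableEq O]

/-- Part of the Laplace exponent that stems from the operators other than `b`. -/
def crossExponent (D : Downlink O Ω) (b : O) (M κ : ℝ) : ℝ :=
  ∑ k ∈ D.group.erase b, D.intensity k * (Real.pi * D.txMoment M k * gapIntegral (D.α / 2) κ 0)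

lemma measurable_laplaceExponent (D : Downlink O Ω) (b : O) (M : ℝ) :
    Measurable fun q : ℝ × ℝ => D.laplaceExponent b M q.1 q.2 := by
  refine Finset.measurable_fun_sum _ fun k _ => Measurable.const_mul (Measurable.const_mul ?_ _) _
  split_ifs
  · exact measurable_gapIntegral _
  · exact (measurable_gapIntegral _).comp (measurable_fst.prodMk measurable_const)

namespace IsRegular

variable [MeasurableSpace Ω] {D : Downlink O Ω} {b : O} {P : Measure Ω} {powerLaw : Measure ℝ}
  {M : ℝ}

lemma laplaceExponent_eq (S : D.IsRegular b powerLaw M P) (κ t : ℝ) :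
    D.laplaceExponent b M κ t
      = Real.pi * D.intensity b * M * gapIntegral (D.α / 2) κ t + D.crossExponent b M κ := by
  rw [laplaceExponent, Finset.sum_coe_sort D.group (fun k => (D.intensity k : ℝ) *
    (Real.pi * D.txMoment M k * gapIntegral (D.α / 2) κ (if k = b then t else 0))),
    ← Finset.add_sum_erase _ _ S.buyer_mem, crossExponent]
  congr 1
  · rw [if_pos rfl, txMoment, if_neg S.buyer_ne]
    ring
  · exact Finset.sum_congr rfl fun k hk => by rw [if_neg (Finset.ne_of_mem_erase hk)]

lemma crossExponent_nonneg (S : D.IsRegular b powerLaw M P) {κ : ℝ} (hκ : 0 ≤ κ) :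
    0 ≤ D.crossExponent b M κ :=
  Finset.sum_nonneg fun k _ => mul_nonneg (NNReal.coe_nonneg _) (mul_nonneg
    (mul_nonneg Real.pi_nonneg (S.txMoment_pos k).le) (gapIntegral_nonneg hκ le_rfl))

lemma rate_pos (S : D.IsRegular b powerLaw M P) : 0 < Real.pi * D.intensity b * M :=
  mul_pos (mul_pos Real.pi_pos S.intensity_pos) S.moment_pos

lemma one_lt_half (S : D.IsRegular b powerLaw M P) : 1 < D.α / 2 := by linarith [S.two_lt]

/-- A bound uniform in `κ`; it provides the exponential majorant for dominated convergence. -/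
lemma le_laplaceExponent (S : D.IsRegular b powerLaw M P) {κ t : ℝ} (hκ : 0 ≤ κ) (ht : 0 ≤ t) :
    Real.pi * D.intensity b * M * t ≤ D.laplaceExponent b M κ t := by
  rw [S.laplaceExponent_eq]
  have h1 : t ≤ gapIntegral (D.α / 2) κ t :=
    le_add_of_nonneg_right (setIntegral_nonneg measurableSet_Ioi fun w hw => by
      have := Real.rpow_nonneg (ht.trans (le_of_lt hw)) (D.α / 2)
      positivity)
  have h2 := mul_le_mul_of_nonneg_left h1 S.rate_pos.le
  linarith [S.crossExponent_nonneg hκ]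

lemma laplaceExponent_zero (S : D.IsRegular b powerLaw M P) (t : ℝ) :
    D.laplaceExponent b M 0 t = Real.pi * D.intensity b * M * t := by
  rw [S.laplaceExponent_eq]
  simp [gapIntegral, crossExponent]

lemma tendsto_laplaceExponent (S : D.IsRegular b powerLaw M P) {κ t : ℝ} {κn : ℕ → ℝ}
    (hκ : 0 ≤ κ) (ht : 0 ≤ t) (hκn : ∀ n, 0 ≤ κn n) (hle : ∀ n, κn n ≤ κ)
    (hlim : Filter.Tendsto κn Filter.atTop (nhds κ)) :
    Filter.Tendsto (fun n => D.laplaceExponent b M (κn n) t) Filter.atTop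
      (nhds (D.laplaceExponent b M κ t)) :=
  tendsto_finsetSum _ fun k _ => Filter.Tendsto.const_mul _ (Filter.Tendsto.const_mul _
    (tendsto_gapIntegral S.one_lt_half hκ (by split_ifs <;> simp [ht]) hκn hle hlim))

/-- The Laplace exponent at the parameter that is relevant for the coverage probability. -/
lemma exp_neg_laplaceExponent (S : D.IsRegular b powerLaw M P) {β u : ℝ} (hβ : 0 < β)
    (hu : 0 < u) :
    Real.exp (-D.laplaceExponent b M (β * u ^ (D.α / 2)) u)
      = Real.exp (-(Real.pi * D.intensity b * M * u))
        * laplaceFormula D b β M (β * u ^ (D.α / 2)) := by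
  have ha := S.one_lt_half
  have ha0 : 0 < D.α / 2 := by linarith
  have hα : D.α ≠ 0 := by linarith [S.two_lt]
  set κ := β * u ^ (D.α / 2) with hκdef
  have hκ : 0 < κ := by positivity
  have hinv : 1 / (D.α / 2) = 2 / D.α := by field_simp
  -- For `κ = β u^(α/2)` the rescaled lower limit no longer depends on `u`; this produces `ρ(α, β)`.
  have hlow : κ ^ (-(1 / (D.α / 2))) * u = β ^ (-(2 / D.α)) := by
    rw [hκdef, Real.mul_rpow hβ.le (by positivity), ← Real.rpow_mul hu.le, hinv]
    have : D.α / 2 * -(2 / D.α) = -1 := by field_simp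
    rw [this, Real.rpow_neg_one, mul_assoc, inv_mul_cancel₀ hu.ne', mul_one]
  have hgu : gapIntegral (D.α / 2) κ u = u + κ ^ (2 / D.α) * rho D.α β := by
    rw [gapIntegral, setIntegral_div_rpow_add ha0 hκ hu.le, hlow, hinv, rho]
  have hg0 : gapIntegral (D.α / 2) κ 0 = κ ^ (2 / D.α) * rhoInf D.α := by
    rw [gapIntegral, setIntegral_div_rpow_add ha0 hκ le_rfl, mul_zero, hinv, rhoInf, zero_add]
  have hcross : D.crossExponent b M κ
      = Real.pi * D.intensity D.seller * D.sellerPower ^ (2 / D.α) * κ ^ (2 / D.α) * rhoInf D.α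
        + Real.pi * (∑ k ∈ D.group \ {D.seller, b}, (D.intensity k : ℝ)) * M * κ ^ (2 / D.α)
          * rhoInf D.α := by
    have hmem : D.seller ∈ D.group.erase b := Finset.mem_erase.2 ⟨S.buyer_ne.symm, S.seller_mem⟩
    have hset : (D.group.erase b).erase D.seller = D.group \ {D.seller, b} := by
      ext k
      simp only [Finset.mem_erase, Finset.mem_sdiff, Finset.mem_insert, Finset.mem_singleton]
      tauto
    rw [crossExponent, ← Finset.add_sum_erase _ _ hmem, hset, hg0]
    congr 1
    · rw [txMoment, if_pos rfl]; ring
    · rw [Finset.mul_sum, Finset.sum_mul, Finset.sum_mul, Finset.sum_mul]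
      refine Finset.sum_congr rfl fun k hk => ?_
      simp only [Finset.mem_sdiff, Finset.mem_insert, not_or] at hk
      rw [txMoment, if_neg hk.2.1]
      ring
  rw [S.laplaceExponent_eq, hgu, hcross, laplaceFormula, ← Real.exp_add, ← Real.exp_add,
    ← Real.exp_add]
  congr 1
  ring

end IsRegular

end Downlink

namespace Downlink

namespace IsRegular

variable {O Ω : Type*} [DecidableEq O] [MeasurableSpace Ω] {D : Downlink O Ω} {b : O}
  {P : Measure Ω} [IsProbabilityMeasure P] {powerLaw : Measure ℝ} {M : ℝ}

/-! ### Joint law of the serving distance variable and the interference -/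

/-- The factor `1 - κ/(Z^(α/2) + κ)` is the Laplace transform of the exponential serving gain at `κ
Z^(-α/2)`, integrated out of the total power. -/
lemma lintegral_Ioi_servingZ (S : D.IsRegular b powerLaw M P) {κ t : ℝ} (hκ : 0 ≤ κ) (ht : 0 ≤ t) :
    ∫⁻ ω, {ω | t < D.servingZ b ω}.indicator (fun ω =>
      ENNReal.ofReal (1 - κ / (D.servingZ b ω ^ (D.α / 2) + κ))
        * nexp (ENNReal.ofReal κ * D.interference b ω)) ω ∂P
      = ENNReal.ofReal (Real.exp (-D.laplaceExponent b M κ t)) := by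
  set g : ℝ × (ℝ × ℝ≥0∞) → ℝ≥0∞ := fun q => {q : ℝ × (ℝ × ℝ≥0∞) | t < q.2.1}.indicator
    (fun q => nexp (ENNReal.ofReal (κ * q.2.1 ^ (-(D.α / 2)) * q.1))
      * nexp (ENNReal.ofReal κ * q.2.2)) q with hg
  have hgm : Measurable g := Measurable.indicator (by fun_prop)
    (measurableSet_lt measurable_const (by fun_prop))
  rw [← S.lintegral_totalPower hκ ht]
  have h1 : ∀ᵐ ω ∂P, {ω | t < D.servingZ b ω}.indicator
      (fun ω => nexp (ENNReal.ofReal κ * D.totalPower ω)) ω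
      = g (D.gain b (D.serving b ω) ω, (D.servingZ b ω, D.interference b ω)) := by
    filter_upwards [S.ae_received_serving] with ω hω
    simp only [hg, indicator, mem_ofPred_eq]
    rw [S.totalPower_eq, hω, mul_add, nexp_add, ← ENNReal.ofReal_mul hκ, mul_assoc]
  rw [lintegral_congr_ae h1, S.lintegral_serving_gain hgm]
  refine lintegral_congr_ae ?_
  filter_upwards [S.ae_servingZ_pos] with ω hZ
  by_cases hω : t < D.servingZ b ω
  · have hpw : 0 < D.servingZ b ω ^ (D.α / 2) := Real.rpow_pos_of_pos hZ _
    rw [indicator_of_mem (by exact hω)]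
    have : ∀ x, g (x, (D.servingZ b ω, D.interference b ω))
        = nexp (ENNReal.ofReal (κ * D.servingZ b ω ^ (-(D.α / 2)) * x))
          * nexp (ENNReal.ofReal κ * D.interference b ω) := fun x => by
      simp only [hg]
      rw [indicator_of_mem (by exact hω)]
    simp_rw [this]
    rw [lintegral_mul_const _ (by fun_prop), lintegral_nexp_mul_expMeasure (by positivity)]
    congr 2
    rw [Real.rpow_neg hZ.le]
    field_simp
    ring
  · rw [indicator_of_notMem (by exact hω)]
    have : ∀ x, g (x, (D.servingZ b ω, D.interference b ω)) = 0 := fun x => by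
      simp only [hg]
      rw [indicator_of_notMem (by exact hω)]
    simp [this]

/-- Both finite measures are carried by `(0, ∞)` and have the tail `e^{-Λ(κ,t)}`: the left one by
the Laplace functional, the right one by integrating the derivative of that tail. -/
lemma map_servingZ_withDensity (S : D.IsRegular b powerLaw M P) {κ : ℝ} (hκ : 0 ≤ κ) :
    (P.withDensity fun ω => ENNReal.ofReal (1 - κ / (D.servingZ b ω ^ (D.α / 2) + κ))
        * nexp (ENNReal.ofReal κ * D.interference b ω)).map (D.servingZ b)
      = (volume.restrict (Ioi 0)).withDensity fun u =>
        ENNReal.ofReal ((1 - κ / (u ^ (D.α / 2) + κ))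
          * (Real.pi * D.intensity b * M * Real.exp (-D.laplaceExponent b M κ u))) := by
  have hZ := S.measurable_servingZ
  have hI := S.measurable_interference
  have hleft : ∀ t, 0 ≤ t → (P.withDensity fun ω =>
      ENNReal.ofReal (1 - κ / (D.servingZ b ω ^ (D.α / 2) + κ))
        * nexp (ENNReal.ofReal κ * D.interference b ω)).map (D.servingZ b) (Ioi t)
      = ENNReal.ofReal (Real.exp (-D.laplaceExponent b M κ t)) := fun t ht => by
    have hms : MeasurableSet {ω | t < D.servingZ b ω} := measurableSet_lt measurable_const hZ
    rw [Measure.map_apply hZ measurableSet_Ioi, withDensity_apply _ (hZ measurableSet_Ioi),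
      ← S.lintegral_Ioi_servingZ hκ ht, lintegral_indicator hms]
    rfl
  have hright : ∀ t, 0 ≤ t → (volume.restrict (Ioi 0)).withDensity (fun u =>
        ENNReal.ofReal ((1 - κ / (u ^ (D.α / 2) + κ))
          * (Real.pi * D.intensity b * M * Real.exp (-D.laplaceExponent b M κ u)))) (Ioi t)
      = ENNReal.ofReal (Real.exp (-D.laplaceExponent b M κ t)) := fun t ht => by
    rw [withDensity_apply _ measurableSet_Ioi, Measure.restrict_restrict measurableSet_Ioi,
      Ioi_inter_Ioi, max_eq_left ht]
    simp_rw [S.laplaceExponent_eq]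
    exact lintegral_Ioi_exp_gapIntegral _ S.one_lt_half hκ S.rate_pos ht
  set ν₁ := (P.withDensity fun ω => ENNReal.ofReal (1 - κ / (D.servingZ b ω ^ (D.α / 2) + κ))
        * nexp (ENNReal.ofReal κ * D.interference b ω)).map (D.servingZ b) with hν₁
  set ν₂ := (volume.restrict (Ioi 0)).withDensity fun u =>
        ENNReal.ofReal ((1 - κ / (u ^ (D.α / 2) + κ))
          * (Real.pi * D.intensity b * M * Real.exp (-D.laplaceExponent b M κ u))) with hν₂
  have hpos₁ : ν₁ (Iic 0) = 0 := by
    rw [hν₁, Measure.map_apply hZ measurableSet_Iic]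
    refine withDensity_absolutelyContinuous _ _ ?_
    have := S.ae_servingZ_pos
    rw [ae_iff] at this
    simp only [not_lt] at this
    exact this
  have hpos₂ : ν₂ (Iic 0) = 0 := by
    refine withDensity_absolutelyContinuous _ _ ?_
    rw [Measure.restrict_apply measurableSet_Iic, Iic_inter_Ioi, Ioc_self, measure_empty]
  have huniv : ∀ ν : Measure ℝ, ν (Iic 0) = 0 → ν univ = ν (Ioi 0) := fun ν h => by
    rw [← Iic_union_Ioi (a := (0 : ℝ)), measure_union (by simp) measurableSet_Ioi, h, zero_add]
  have hfin : IsFiniteMeasure ν₁ := ⟨by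
    rw [huniv _ hpos₁, hleft 0 le_rfl]
    exact ENNReal.ofReal_lt_top⟩
  have hfin₂ : IsFiniteMeasure ν₂ := ⟨by
    rw [huniv _ hpos₂, hright 0 le_rfl]
    exact ENNReal.ofReal_lt_top⟩
  refine Measure.ext_of_Iic _ _ fun t => ?_
  rcases le_total t 0 with ht | ht
  · rw [measure_mono_null (Iic_subset_Iic.2 ht) hpos₁, measure_mono_null (Iic_subset_Iic.2 ht) hpos₂]
  · rw [← compl_Ioi, measure_compl measurableSet_Ioi (measure_ne_top _ _),
      measure_compl measurableSet_Ioi (measure_ne_top _ _), huniv _ hpos₁, huniv _ hpos₂,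
      hleft 0 le_rfl, hright 0 le_rfl, hleft t ht, hright t ht]

/-- The weight `w` of the serving gain is a factor of both densities and is positive on `(0, ∞)`, so
testing with `φ / w` cancels it and leaves the interference alone. -/
lemma lintegral_servingZ_const (S : D.IsRegular b powerLaw M P) {κ : ℝ} (hκ : 0 ≤ κ)
    {φ : ℝ → ℝ≥0∞} (hφ : Measurable φ) :
    ∫⁻ ω, φ (D.servingZ b ω) * nexp (ENNReal.ofReal κ * D.interference b ω) ∂P
      = ∫⁻ u in Ioi 0, φ u * ENNReal.ofReal
        (Real.pi * D.intensity b * M * Real.exp (-D.laplaceExponent b M κ u)) := by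
  have hZ := S.measurable_servingZ
  have hI := S.measurable_interference
  set w : ℝ → ℝ≥0∞ := fun u => ENNReal.ofReal (1 - κ / (u ^ (D.α / 2) + κ)) with hw
  have hwm : Measurable w := by fun_prop
  have hw1 : ∀ u, 0 < u → (w u)⁻¹ * w u = 1 := fun u hu => by
    have hpw : 0 < u ^ (D.α / 2) := Real.rpow_pos_of_pos hu _
    refine ENNReal.inv_mul_cancel ?_ ENNReal.ofReal_ne_top
    rw [hw, ne_eq, ENNReal.ofReal_eq_zero, not_le, sub_pos, div_lt_one (by positivity)]
    linarith
  have hlapm : Measurable fun u => ENNReal.ofReal ((1 - κ / (u ^ (D.α / 2) + κ))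
      * (Real.pi * D.intensity b * M * Real.exp (-D.laplaceExponent b M κ u))) := by
    have : Measurable fun u => D.laplaceExponent b M κ u :=
      (measurable_laplaceExponent D b M).comp (measurable_const.prodMk measurable_id)
    fun_prop
  have h := congrArg (fun ν : Measure ℝ => ∫⁻ u, φ u * (w u)⁻¹ ∂ν) (S.map_servingZ_withDensity hκ)
  beta_reduce at h
  rw [lintegral_map (by fun_prop) hZ, lintegral_withDensity_eq_lintegral_mul _ (by fun_prop)
    (by fun_prop), lintegral_withDensity_eq_lintegral_mul _ hlapm (by fun_prop)] at h
  rw [← lintegral_congr_ae (μ := volume.restrict (Ioi 0)) ?_, ← h]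
  · refine lintegral_congr_ae ?_
    filter_upwards [S.ae_servingZ_pos] with ω hω
    have := hw1 _ hω
    simp only [Pi.mul_apply]
    rw [show ENNReal.ofReal (1 - κ / (D.servingZ b ω ^ (D.α / 2) + κ)) = w (D.servingZ b ω) from rfl]
    calc _ = φ (D.servingZ b ω) * 1 * nexp (ENNReal.ofReal κ * D.interference b ω) := by rw [mul_one]
      _ = _ := by rw [← this]; ring
  · filter_upwards [ae_restrict_mem measurableSet_Ioi] with u hu
    have := hw1 _ hu
    simp only [Pi.mul_apply]
    rw [ENNReal.ofReal_mul' (mul_nonneg S.rate_pos.le (Real.exp_nonneg _)),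
      show ENNReal.ofReal (1 - κ / (u ^ (D.α / 2) + κ)) = w u from rfl]
    generalize ENNReal.ofReal
      (Real.pi * D.intensity b * M * Real.exp (-D.laplaceExponent b M κ u)) = v
    calc w u * v * (φ u * (w u)⁻¹) = φ u * ((w u)⁻¹ * w u) * v := by ring
      _ = _ := by rw [this, mul_one]

end IsRegular

end Downlink

/-! ### Laplace parameters that depend on the serving distance variable. -/

namespace Downlink

namespace IsRegular

variable {O Ω : Type*} [DecidableEq O] [MeasurableSpace Ω] {D : Downlink O Ω} {b : O}
  {P : Measure Ω} [IsProbabilityMeasure P] {powerLaw : Measure ℝ} {M : ℝ}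

/-- On each set `q(Z) = j` the parameter is constant; the countably many pieces are summed. -/
lemma lintegral_servingZ_countable (S : D.IsRegular b powerLaw M P) {q : ℝ → ℕ} (hq : Measurable q)
    (d : ℕ) {φ : ℝ → ℝ≥0∞} (hφ : Measurable φ) :
    ∫⁻ ω, φ (D.servingZ b ω)
        * nexp (ENNReal.ofReal (q (D.servingZ b ω) / d) * D.interference b ω) ∂P
      = ∫⁻ u in Ioi 0, φ u * ENNReal.ofReal
        (Real.pi * D.intensity b * M * Real.exp (-D.laplaceExponent b M (q u / d) u)) := by
  have hZ := S.measurable_servingZ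
  have hI := S.measurable_interference
  have hqj : ∀ j, MeasurableSet (q ⁻¹' {j}) := fun j => hq (measurableSet_singleton j)
  have hlapm : ∀ κ, Measurable fun u => ENNReal.ofReal
      (Real.pi * D.intensity b * M * Real.exp (-D.laplaceExponent b M κ u)) := fun κ => by
    have : Measurable fun u => D.laplaceExponent b M κ u :=
      (measurable_laplaceExponent D b M).comp (measurable_const.prodMk measurable_id)
    fun_prop
  have hL : ∀ ω, φ (D.servingZ b ω)
        * nexp (ENNReal.ofReal (q (D.servingZ b ω) / d) * D.interference b ω)
      = ∑' j : ℕ, (q ⁻¹' {j}).indicator φ (D.servingZ b ω)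
        * nexp (ENNReal.ofReal (j / d) * D.interference b ω) := fun ω => by
    rw [tsum_eq_single (q (D.servingZ b ω)) fun j hj => by
      rw [indicator_of_notMem (by simpa using hj.symm), zero_mul], indicator_of_mem (by simp)]
  have hR : ∀ u, φ u * ENNReal.ofReal
        (Real.pi * D.intensity b * M * Real.exp (-D.laplaceExponent b M (q u / d) u))
      = ∑' j : ℕ, (q ⁻¹' {j}).indicator φ u * ENNReal.ofReal
        (Real.pi * D.intensity b * M * Real.exp (-D.laplaceExponent b M (j / d) u)) := fun u => by
    rw [tsum_eq_single (q u) fun j hj => by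
      rw [indicator_of_notMem (by simpa using hj.symm), zero_mul], indicator_of_mem (by simp)]
  simp_rw [hL, hR]
  rw [lintegral_tsum (f := fun (j : ℕ) ω => (q ⁻¹' {j}).indicator φ (D.servingZ b ω)
      * nexp (ENNReal.ofReal (j / d) * D.interference b ω))
      fun j => (((hφ.indicator (hqj j)).comp hZ).mul (by fun_prop)).aemeasurable,
    lintegral_tsum (f := fun (j : ℕ) u => (q ⁻¹' {j}).indicator φ u * ENNReal.ofReal
      (Real.pi * D.intensity b * M * Real.exp (-D.laplaceExponent b M (j / d) u)))
      fun j => ((hφ.indicator (hqj j)).mul (hlapm _)).aemeasurable]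
  exact tsum_congr fun j => S.lintegral_servingZ_const (by positivity) (hφ.indicator (hqj j))

/-- Joint law of the serving distance variable and of the interference: for a Laplace parameter
that depends on the serving distance variable. -/
lemma lintegral_servingZ (S : D.IsRegular b powerLaw M P) {κ : ℝ → ℝ} (hκm : Measurable κ)
    (hκ : ∀ z, 0 ≤ κ z) {φ : ℝ → ℝ≥0∞} (hφ : Measurable φ) (hφ1 : ∀ z, φ z ≤ 1) :
    ∫⁻ ω, φ (D.servingZ b ω)
        * nexp (ENNReal.ofReal (κ (D.servingZ b ω)) * D.interference b ω) ∂P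
      = ∫⁻ u in Ioi 0, φ u * ENNReal.ofReal
        (Real.pi * D.intensity b * M * Real.exp (-D.laplaceExponent b M (κ u) u)) := by
  have hZ := S.measurable_servingZ
  have hI := S.measurable_interference
  -- `⌊κ d⌋/d` approximates `κ` from below; for `d = 0` the quotient is `0`.
  set q : ℕ → ℝ → ℕ := fun d z => ⌊κ z * d⌋₊ with hq
  have hqm : ∀ d, Measurable (q d) := fun d => Nat.measurable_floor.comp (hκm.mul_const _)
  have hq0 : ∀ d z, 0 ≤ (q d z : ℝ) / d := fun d z => by positivity
  have hqle : ∀ d z, (q d z : ℝ) / d ≤ κ z := fun d z =>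
    div_le_of_le_mul₀ (Nat.cast_nonneg d) (hκ z)
      (Nat.floor_le (mul_nonneg (hκ z) (Nat.cast_nonneg d)))
  have hqlim : ∀ z, Filter.Tendsto (fun d : ℕ => (q d z : ℝ) / d) Filter.atTop (nhds (κ z)) :=
    fun z => (tendsto_nat_floor_mul_div_atTop (hκ z)).comp tendsto_natCast_atTop_atTop
  refine tendsto_nhds_unique (f := fun d : ℕ => ∫⁻ ω, φ (D.servingZ b ω)
    * nexp (ENNReal.ofReal (q d (D.servingZ b ω) / d) * D.interference b ω) ∂P)
    (l := Filter.atTop) ?_ ?_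
  · refine tendsto_lintegral_of_dominated_convergence (fun _ => 1) (fun d => ?_)
      (fun d => .of_forall fun ω => mul_le_one' (hφ1 _) (nexp_le_one _)) (by simp) ?_
    · have := hqm d
      fun_prop
    -- Multiplication by the interference preserves the limit because the interference is finite,
    -- even when `κ = 0`.
    · filter_upwards [S.ae_interference_ne_top] with ω hω
      refine ENNReal.Tendsto.const_mul ((continuous_nexp.tendsto _).comp
        (ENNReal.Tendsto.mul_const (ENNReal.tendsto_ofReal (hqlim _)) (Or.inr hω)))
        (Or.inr ((hφ1 _).trans_lt ENNReal.one_lt_top).ne)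
  · simp_rw [S.lintegral_servingZ_countable (hqm _) _ hφ]
    have hc := S.rate_pos
    refine tendsto_lintegral_of_dominated_convergence (fun u => ENNReal.ofReal
      (Real.pi * D.intensity b * M * Real.exp (-(Real.pi * D.intensity b * M) * u))) (fun d => ?_)
      (fun d => ?_) ?_ ?_
    · have h1 := hqm d
      have h2 : Measurable fun u => D.laplaceExponent b M (q d u / d) u :=
        (measurable_laplaceExponent D b M).comp (Measurable.prodMk (by fun_prop) measurable_id)
      fun_prop
    · filter_upwards [ae_restrict_mem measurableSet_Ioi] with u hu
      refine (mul_le_mul_left (hφ1 u) _).trans ?_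
      rw [one_mul]
      refine ENNReal.ofReal_le_ofReal (mul_le_mul_of_nonneg_left (Real.exp_le_exp.2 ?_) hc.le)
      rw [neg_mul]
      exact neg_le_neg (S.le_laplaceExponent (hq0 d u) (le_of_lt hu))
    · have h := ((integrableOn_exp_mul_Ioi (neg_lt_zero.2 hc) 0).const_mul
        (Real.pi * D.intensity b * M)).2
      rw [hasFiniteIntegral_iff_ofReal
        (.of_forall fun u => mul_nonneg hc.le (Real.exp_nonneg _))] at h
      exact h.ne
    · filter_upwards [ae_restrict_mem measurableSet_Ioi] with u hu
      refine ENNReal.Tendsto.const_mul (ENNReal.tendsto_ofReal (Filter.Tendsto.const_mul _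
        ((Real.continuous_exp.tendsto _).comp (Filter.Tendsto.neg ?_))))
        (Or.inr ((hφ1 _).trans_lt ENNReal.one_lt_top).ne)
      exact S.tendsto_laplaceExponent (hκ u) (le_of_lt hu) (fun d => hq0 d u)
        (fun d => hqle d u) (hqlim u)

lemma lintegral_servingZ_law (S : D.IsRegular b powerLaw M P) {φ : ℝ → ℝ≥0∞} (hφ : Measurable φ) :
    ∫⁻ ω, φ (D.servingZ b ω) ∂P = ∫⁻ u in Ioi 0, φ u * ENNReal.ofReal
      (Real.pi * D.intensity b * M * Real.exp (-(Real.pi * D.intensity b * M * u))) := by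
  simpa [S.laplaceExponent_zero] using S.lintegral_servingZ_const le_rfl hφ

lemma lintegral_servingZ_coverage (S : D.IsRegular b powerLaw M P) {β : ℝ} (hβ : 0 < β)
    {φ : ℝ → ℝ≥0∞} (hφ : Measurable φ) (hφ1 : ∀ z, φ z ≤ 1) :
    ∫⁻ ω, φ (D.servingZ b ω) * nexp (ENNReal.ofReal (β * D.servingZ b ω ^ (D.α / 2))
        * D.interference b ω) ∂P
      = ∫⁻ u in Ioi 0, φ u * ENNReal.ofReal (Real.pi * D.intensity b * M
        * (Real.exp (-(Real.pi * D.intensity b * M * u))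
          * laplaceFormula D b β M (β * u ^ (D.α / 2)))) := by
  -- The absolute value makes the parameter nonnegative for every `z`; it has no effect where `Z >
  -- 0`.
  have h := S.lintegral_servingZ (κ := fun z => β * |z| ^ (D.α / 2)) (by fun_prop)
    (fun z => by positivity) hφ hφ1
  refine Eq.trans ?_ (h.trans ?_)
  · refine lintegral_congr_ae ?_
    filter_upwards [S.ae_servingZ_pos] with ω hω
    rw [abs_of_pos hω]
  · refine setLIntegral_congr_fun measurableSet_Ioi fun u hu => ?_
    rw [abs_of_pos (mem_Ioi.1 hu), S.exp_neg_laplaceExponent hβ hu]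

/-! ### Conditional Laplace transform of the interference. -/

lemma rho_nonneg (α : ℝ) {β : ℝ} (hβ : 0 ≤ β) : 0 ≤ rho α β :=
  setIntegral_nonneg measurableSet_Ioi fun v hv => by
    have : 0 ≤ v ^ (α / 2) := Real.rpow_nonneg ((Real.rpow_nonneg hβ _).trans (le_of_lt hv)) _
    positivity

lemma rhoInf_nonneg (α : ℝ) : 0 ≤ rhoInf α :=
  setIntegral_nonneg measurableSet_Ioi fun v hv => by
    have : 0 ≤ v ^ (α / 2) := Real.rpow_nonneg (le_of_lt hv) _
    positivity

lemma laplaceFormula_nonneg (D : Downlink O Ω) (b : O) (β M κ : ℝ) :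
    0 ≤ laplaceFormula D b β M κ := by
  unfold laplaceFormula
  positivity

lemma laplaceFormula_le_one (S : D.IsRegular b powerLaw M P) {β κ : ℝ} (hβ : 0 < β) (hκ : 0 ≤ κ) :
    laplaceFormula D b β M κ ≤ 1 := by
  have h1 := rho_nonneg D.α hβ.le
  have h2 := rhoInf_nonneg D.α
  have h3 := S.moment_pos
  have h4 := S.sellerPower_pos
  have h5 := Real.pi_pos
  have h6 : 0 ≤ ∑ k ∈ D.group \ {D.seller, b}, (D.intensity k : ℝ) :=
    Finset.sum_nonneg fun k _ => NNReal.coe_nonneg _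
  unfold laplaceFormula
  refine mul_le_one₀ (mul_le_one₀ ?_ (Real.exp_nonneg _) ?_) (Real.exp_nonneg _) ?_ <;>
  · rw [Real.exp_le_one_iff, neg_nonpos]
    positivity

@[fun_prop]
lemma measurable_laplaceFormula (D : Downlink O Ω) (b : O) (β M : ℝ) :
    Measurable fun κ => laplaceFormula D b β M κ := by
  unfold laplaceFormula
  fun_prop

/-- The conditional Laplace transform of the interference. -/
theorem condExp_interference (S : D.IsRegular b powerLaw M P) {β : ℝ} (hβ : 0 < β) :
    P[fun ω => Real.exp (-(β * D.servingZ b ω ^ (D.α / 2) * (D.interference b ω).toReal)) |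
        MeasurableSpace.comap (D.servingZ b) inferInstance]
      =ᵐ[P] (fun ω => laplaceFormula D b β M (β * D.servingZ b ω ^ (D.α / 2))) := by
  have hZ := S.measurable_servingZ
  have hI := S.measurable_interference
  have hfm : Measurable fun ω =>
      Real.exp (-(β * D.servingZ b ω ^ (D.α / 2) * (D.interference b ω).toReal)) := by fun_prop
  have hgm : Measurable fun z => laplaceFormula D b β M (β * z ^ (D.α / 2)) := by fun_prop
  have hfint : Integrable (fun ω =>
      Real.exp (-(β * D.servingZ b ω ^ (D.α / 2) * (D.interference b ω).toReal))) P := by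
    refine Integrable.of_bound hfm.aestronglyMeasurable 1 ?_
    filter_upwards [S.ae_servingZ_pos] with ω hω
    rw [Real.norm_of_nonneg (Real.exp_nonneg _), Real.exp_le_one_iff, neg_nonpos]
    positivity
  have hgint : Integrable (fun ω => laplaceFormula D b β M (β * D.servingZ b ω ^ (D.α / 2))) P := by
    refine Integrable.of_bound (hgm.comp hZ).aestronglyMeasurable 1 ?_
    filter_upwards [S.ae_servingZ_pos] with ω hω
    rw [Real.norm_of_nonneg (laplaceFormula_nonneg _ _ _ _ _)]
    exact S.laplaceFormula_le_one hβ (by positivity)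
  refine (ae_eq_condExp_of_forall_setIntegral_eq hZ.comap_le hfint
    (fun s _ _ => hgint.integrableOn) ?_ ?_).symm
  · rintro _ ⟨A, hA, rfl⟩ -
    rw [integral_eq_lintegral_of_nonneg_ae
        (.of_forall fun ω => laplaceFormula_nonneg _ _ _ _ _)
        (hgm.comp hZ).aestronglyMeasurable,
      integral_eq_lintegral_of_nonneg_ae (.of_forall fun ω => Real.exp_nonneg _)
        hfm.aestronglyMeasurable]
    congr 1
    have hAm := hZ hA
    have h1 : ∫⁻ ω in D.servingZ b ⁻¹' A,
        ENNReal.ofReal (laplaceFormula D b β M (β * D.servingZ b ω ^ (D.α / 2))) ∂P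
        = ∫⁻ ω, (fun z => A.indicator
          (fun z => ENNReal.ofReal (laplaceFormula D b β M (β * z ^ (D.α / 2)))) z)
            (D.servingZ b ω) ∂P := by
      rw [← lintegral_indicator hAm]
      rfl
    have h2 : ∫⁻ ω in D.servingZ b ⁻¹' A, ENNReal.ofReal
        (Real.exp (-(β * D.servingZ b ω ^ (D.α / 2) * (D.interference b ω).toReal))) ∂P
        = ∫⁻ ω, A.indicator 1 (D.servingZ b ω) * nexp (ENNReal.ofReal
          (β * D.servingZ b ω ^ (D.α / 2)) * D.interference b ω) ∂P := by
      rw [← lintegral_indicator hAm]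
      refine lintegral_congr_ae ?_
      filter_upwards [S.ae_servingZ_pos, S.ae_interference_ne_top] with ω hω hωI
      by_cases hωA : D.servingZ b ω ∈ A
      · rw [indicator_of_mem (by exact hωA), indicator_of_mem hωA, Pi.one_apply, one_mul,
          nexp_eq_ofReal (ENNReal.mul_ne_top ENNReal.ofReal_ne_top hωI), ENNReal.toReal_mul,
          ENNReal.toReal_ofReal (by positivity)]
      · rw [indicator_of_notMem (by exact hωA), indicator_of_notMem hωA, zero_mul]
    -- Over `Z ∈ A` both integrals become that of `c e^{-cu} 𝓛(β u^(α/2))` over `A ∩ (0, ∞)`: one by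
    -- the law of `Z`, the other by the joint identity.
    rw [h1, h2, S.lintegral_servingZ_law ((hgm.ennreal_ofReal).indicator hA),
      S.lintegral_servingZ_coverage hβ (measurable_one.indicator hA)
        fun z => indicator_le_self' (fun _ _ => zero_le) z]
    refine lintegral_congr fun u => ?_
    by_cases hu : u ∈ A
    · rw [indicator_of_mem hu, indicator_of_mem hu, Pi.one_apply, one_mul,
        ← ENNReal.ofReal_mul (laplaceFormula_nonneg _ _ _ _ _)]
      congr 1
      ring
    · rw [indicator_of_notMem hu, indicator_of_notMem hu, zero_mul, zero_mul]
  · exact (hgm.comp (comap_measurable _)).aestronglyMeasurable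

/-! ### Coverage probability. -/

lemma coverageIntegrand_nonneg (S : D.IsRegular b powerLaw M P) (β z : ℝ) :
    0 ≤ coverageIntegrand D b β M z :=
  mul_nonneg (mul_nonneg (mul_nonneg S.rate_pos.le (Real.exp_nonneg _)) (Real.exp_nonneg _))
    (laplaceFormula_nonneg _ _ _ _ _)

lemma measurable_coverageIntegrand (D : Downlink O Ω) (b : O) (β M : ℝ) :
    Measurable (coverageIntegrand D b β M) := by
  unfold coverageIntegrand
  fun_prop

/-- Coverage means that the serving gain exceeds `β Z^(α/2) (I + σ²)`. Given `(Z, I)` this has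
probability `e^{-β Z^(α/2) (I + σ²)}`; the noise part is a bounded function of `Z`, and the rest is
the joint identity. -/
lemma measure_lt_sinr (S : D.IsRegular b powerLaw M P) {β : ℝ} (hβ : 0 < β) :
    P {ω | ENNReal.ofReal β < D.sinr b ω}
      = ∫⁻ z in Ioi 0, ENNReal.ofReal (coverageIntegrand D b β M z) := by
  have hZ := S.measurable_servingZ
  have hI := S.measurable_interference
  set B : Set (ℝ × (ℝ × ℝ≥0∞)) := {q | ENNReal.ofReal (β * q.2.1 ^ (D.α / 2))
    * (q.2.2 + ENNReal.ofReal (D.σ ^ 2)) < ENNReal.ofReal q.1} with hB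
  have hBm : MeasurableSet B := measurableSet_lt (by fun_prop) (by fun_prop)
  have hset : {ω | ENNReal.ofReal β < D.sinr b ω} =ᵐ[P]
      {ω | (D.gain b (D.serving b ω) ω, (D.servingZ b ω, D.interference b ω)) ∈ B} := by
    filter_upwards [S.ae_servingZ_pos, S.ae_interference_ne_top, S.ae_received_serving]
      with ω hω hωI hrec
    have hpw : 0 < D.servingZ b ω ^ (D.α / 2) := Real.rpow_pos_of_pos hω _
    refine propext ?_
    change ENNReal.ofReal β < D.sinr b ω ↔ ENNReal.ofReal (β * D.servingZ b ω ^ (D.α / 2))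
      * (D.interference b ω + ENNReal.ofReal (D.σ ^ 2)) < ENNReal.ofReal (D.gain b (D.serving b ω) ω)
    have hdiv : D.received b (D.serving b ω) ω = ENNReal.ofReal (D.gain b (D.serving b ω) ω)
        / ENNReal.ofReal (D.servingZ b ω ^ (D.α / 2)) := by
      rw [hrec, ← ENNReal.ofReal_div_of_pos hpw, Real.rpow_neg hω.le, mul_comm]
      exact congrArg ENNReal.ofReal (div_eq_mul_inv _ _).symm
    rw [sinr, ENNReal.lt_div_iff_mul_lt (Or.inr ENNReal.ofReal_ne_top)
      (Or.inl (ENNReal.add_ne_top.2 ⟨hωI, ENNReal.ofReal_ne_top⟩)), hdiv,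
      ENNReal.lt_div_iff_mul_lt (Or.inl (by simpa using hpw)) (Or.inl ENNReal.ofReal_ne_top),
      ENNReal.ofReal_mul hβ.le, mul_right_comm]
  rw [measure_congr hset]
  have hm : MeasurableSet
      {ω | (D.gain b (D.serving b ω) ω, (D.servingZ b ω, D.interference b ω)) ∈ B} := by
    have hN : Measurable (D.serving b) := measurable_to_countable' fun n =>
      measurableSet_serving_eq (S.measurable_bs S.buyer_mem)
        (S.model.power_measurable b S.buyer_mem_erase) n
    exact ((measurable_apply_of_countable hN fun n => S.model.gain_measurable b S.buyer_mem n).prodMk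
      S.measurable_servingZ_interference) hBm
  rw [← lintegral_indicator_one hm]
  have h1 := S.lintegral_serving_gain (g := B.indicator 1) (measurable_one.indicator hBm)
  refine Eq.trans h1 ?_
  have h2 : ∀ ω, ∫⁻ x, B.indicator 1 (x, (D.servingZ b ω, D.interference b ω)) ∂(expMeasure 1)
      = nexp (ENNReal.ofReal (β * D.servingZ b ω ^ (D.α / 2))
        * (D.interference b ω + ENNReal.ofReal (D.σ ^ 2))) := fun ω => by
    rw [← expMeasure_lt_ofReal, ← lintegral_indicator_one
      (measurableSet_lt measurable_const (by fun_prop))]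
    rfl
  simp_rw [h2, mul_add, nexp_add]
  have h3 := S.lintegral_servingZ_coverage hβ (φ := fun z =>
    nexp (ENNReal.ofReal (β * z ^ (D.α / 2)) * ENNReal.ofReal (D.σ ^ 2))) (by fun_prop)
    (fun z => nexp_le_one _)
  simp_rw [mul_comm (nexp (_ * D.interference b _))]
  rw [h3]
  refine setLIntegral_congr_fun measurableSet_Ioi fun u hu => ?_
  have hpw : 0 < u ^ (D.α / 2) := Real.rpow_pos_of_pos hu _
  rw [← ENNReal.ofReal_mul (by positivity), nexp_ofReal (by positivity),
    ← ENNReal.ofReal_mul (Real.exp_nonneg _), coverageIntegrand]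
  congr 1
  rw [show β * D.σ ^ 2 * u ^ (D.α / 2) = β * u ^ (D.α / 2) * D.σ ^ 2 by ring]
  ring

/-- The integrand is nonnegative and its lower integral is a probability. -/
lemma integrableOn_coverageIntegrand (S : D.IsRegular b powerLaw M P) {β : ℝ} (hβ : 0 < β) :
    IntegrableOn (coverageIntegrand D b β M) (Ioi 0) := by
  refine ⟨(measurable_coverageIntegrand D b β M).aestronglyMeasurable, ?_⟩
  rw [hasFiniteIntegral_iff_ofReal (.of_forall fun z => S.coverageIntegrand_nonneg β z),
    ← S.measure_lt_sinr hβ]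
  exact measure_lt_top _ _

/-- The coverage probability. -/
theorem measureReal_lt_sinr (S : D.IsRegular b powerLaw M P) {β : ℝ} (hβ : 0 < β) :
    P.real {ω | ENNReal.ofReal β < D.sinr b ω} = ∫ z in Ioi 0, coverageIntegrand D b β M z := by
  rw [measureReal_def, S.measure_lt_sinr hβ, integral_eq_lintegral_of_nonneg_ae
    (.of_forall fun z => S.coverageIntegrand_nonneg β z)
    (measurable_coverageIntegrand D b β M).aestronglyMeasurable]

end IsRegular

end Downlink

end SpectrumSharing

end

theorem theorem1 {O Ω Ω' : Type*} [DecidableEq O] [MeasurableSpace Ω] [MeasurableSpace Ω']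
    (P : Measure Ω) [IsProbabilityMeasure P] (P' : Measure Ω') [IsProbabilityMeasure P']
    (D : Downlink O Ω) (b : O)
    (hseller : D.seller ∈ D.group) (hbuyer : b ∈ D.group) (hne : b ≠ D.seller)
    (hintensity : ∀ k ∈ D.group, 0 < D.intensity k)
    (hα : 2 < D.α) (hpower : 0 < D.sellerPower)
    -- the users of the seller, seen from a buyer base station at `x`
    (userIntensity : ℝ≥0) (huser : 0 < userIntensity) (ζ : ℝ) (hζ : 0 < ζ)
    (Y : ℕ → Ω' → Plane) (g : ℕ → Ω' → ℝ) (hY : IsUserField Y g userIntensity P') (x : Plane)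
    (hD : D.IsModel (P'.map (maxPower D.α ζ x Y g)) P)
    (β : ℝ) (hβ : 0 < β) (M : ℝ)
    (hM : M = ∫ ω, maxPower D.α ζ x Y g ω ^ (2 / D.α) ∂P') :
    -- the quantities in the formula are well defined
    (Integrable (fun ω => maxPower D.α ζ x Y g ω ^ (2 / D.α)) P' ∧
      IntegrableOn (fun v : ℝ => 1 / (1 + v ^ (D.α / 2))) (Ioi 0) ∧
      (∀ᵐ ω ∂P, D.interference b ω ≠ ∞)) ∧
    -- the Laplace transform of the interference, given the serving base station
    P[fun ω => Real.exp (-(β * D.servingZ b ω ^ (D.α / 2) * (D.interference b ω).toReal)) |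
        MeasurableSpace.comap (D.servingZ b) inferInstance]
      =ᵐ[P] (fun ω => laplaceFormula D b β M (β * D.servingZ b ω ^ (D.α / 2))) ∧
    -- the coverage probability
    IntegrableOn (coverageIntegrand D b β M) (Ioi 0) ∧
    P.real {ω | ENNReal.ofReal β < D.sinr b ω} = ∫ z in Ioi 0, coverageIntegrand D b β M z := by
  have hα0 : 0 < D.α := by linarith
  have hint := hY.integrable_maxPower_rpow huser hα0 x hζ
  have hpos := hY.ae_maxPower_pos huser hα0 x hζ
  have hmeas := hY.measurable_maxPower D.α ζ x
  have hnn : ∀ ω, 0 ≤ maxPower D.α ζ x Y g ω ^ (2 / D.α) := fun ω =>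
    Real.rpow_nonneg ENNReal.toReal_nonneg _
  -- From the users of the seller only this remains: the transmit power is almost surely positive
  -- and its moment of order `2/α` is finite and positive.
  have S : D.IsRegular b (P'.map (maxPower D.α ζ x Y g)) M P :=
    { model := hD
      seller_mem := hseller
      buyer_mem := hbuyer
      buyer_ne := hne
      intensity_pos := hintensity b hbuyer
      two_lt := hα
      sellerPower_pos := hpower
      isProbabilityMeasure := Measure.isProbabilityMeasure_map hmeas.aemeasurable
      ae_pos := (ae_map_iff hmeas.aemeasurable measurableSet_Ioi).2 hpos
      moment := by
        rw [lintegral_map (by fun_prop) hmeas, hM,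
          ofReal_integral_eq_lintegral_ofReal hint (.of_forall hnn)]
      moment_pos := by
        rw [hM, integral_pos_iff_support_of_nonneg hnn hint]
        have hsupp : (Function.support fun ω => maxPower D.α ζ x Y g ω ^ (2 / D.α)) =ᵐ[P'] univ := by
          filter_upwards [hpos] with ω hω
          exact propext ⟨fun _ => trivial, fun _ => (Real.rpow_pos_of_pos hω _).ne'⟩
        rw [measure_congr hsupp, measure_univ]
        exact one_pos }
  exact ⟨⟨hint, integrableOn_one_div_one_add_rpow S.one_lt_half, S.ae_interference_ne_top⟩,
    S.condExp_interference hβ, S.integrableOn_coverageIntegrand hβ, S.measureReal_lt_sinr hβ⟩
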